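/- The $\mathsf{ASYNC\ LOCAL}$ model. The nodes of a finite simple graph $G=(V,E)$ on $n$ nodes have pairwise distinct identifiers in $\{1,\dots,N\}$, where $N\le P(n)$ for a polynomial $P$; every node knows its identifier, $N$ and an upper bound $\Delta$ on the maximum degree of $G$, and nothing else about $G$. A deterministic algorithm gives every node an initial state, and a rule that maps the current state of the node and the set of contents of the registers of its neighbors to its new state; some states are terminal and carry an output. A scheduling is an arbitrary sequence $S_1,S_2,\dots$ of subsets of $V$. At step $i$, all nodes of $S_i$ simultaneously write their states in their registers (which initially contain $\bot$), then all of them read the registers of their neighbors, and those that have not terminated update their states. A node that is never scheduled again has crashed. The runtime of a node in an execution is the number of steps at which it is scheduled while it has not terminated. Theorem. There are an algorithm $\mathcal A$ in the $\mathsf{ASYNC\ LOCAL}$ model and a function $f:\mathbb N\to\mathbb N$ such that, for every polynomial $P$, there is a function $r(n)=O(\log^* n)$ with the following property. For every $\Delta\ge 2$, every finite simple graph $G$ of maximum degree at most $\Delta$, with $n$ nodes, every $N\le P(n)$, every assignment of distinct identifiers in $\{1,\dots,N\}$ to the nodes, and every scheduling, 1. all outputs of $\mathcal A$ belong to a palette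 of $\tfrac12(\Delta+1)(\Delta+2)-1$ colors, and any two adjacent nodes that both terminate have different outputs; 2. the runtime of every node is at most $r(n)+f(\Delta)$; in particular, every node that is scheduled more than $r(n)+f(\Delta)$ times terminates, whatever the other nodes do (crash or not). In other words, the round-complexity of $\bigl(\tfrac12(\Delta+1)(\Delta+2)-1\bigr)$-coloring graphs of maximum degree $\Delta$ in $\mathsf{ASYNC\ LOCAL}$ is $O(\log^* n)+f(\Delta)$. -/

import Mathlib

open Asymptotics Filter

noncomputable section

namespace AsyncLocal

/-- A deterministic algorithm of the `ASYNC LOCAL` model, for nodes that receive an identifier in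
`ℕ` and an input in `Input`, and that output natural numbers.

* `State` is the type of states of a node; no bound is put on the size of a state.
* `init` gives the initial state of a node from its identifier and its input.
* `next` gives the new state of a node from its current state and from the set of the contents of
  the registers of its neighbors, `none` being the content of a register that was never written.
* `output s = some x` means that `s` is a terminal state, with output `x`;
  `output s = none` means that a node in state `s` has not terminated. -/
structure Algorithm (Input : Type) where
  State : Type
  init : ℕ → Input → State
  next : State → Set (Option State) → State
  output : State → Option ℕ

/-- A scheduling of the nodes in `V`: the set of nodes that are activated at each step. Any sequence
of sets is allowed; a node that is never activated from some step on has crashed. -/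
abbrev Scheduling (V : Type) := ℕ → Set V

/-- A global configuration: `old v` is the content of the register of `v` (what its neighbors read,
`none` if `v` has not yet written), and `new v` is the current state of `v`, which becomes visible
the next time that `v` is activated. -/
structure Config (State V : Type) where
  old : V → Option State
  new : V → State

variable {Input V : Type}

/-- The initial configuration on nodes with identifiers `ident`, all given the input `inp`. -/
def Algorithm.initial (A : Algorithm Input) (ident : V → ℕ) (inp : Input) : Config A.State V where
  old := fun _ => none
  new := fun v => A.init (ident v) inp

/-- The registers after the activated nodes (those of `S`) have written their states. -/
def Algorithm.write (A : Algorithm Input) (S : Set V) (c : Config A.State V) (v : V) :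
    Option A.State :=
  open Classical in if v ∈ S then some (c.new v) else c.old v

/-- One step: all activated nodes simultaneously write their states in their registers, then all of
them read the registers of their neighbors, and those that have not terminated update their
states. -/
def Algorithm.step (A : Algorithm Input) (G : SimpleGraph V) (S : Set V) (c : Config A.State V) :
    Config A.State V where
  old := A.write S c
  new := fun v =>
    open Classical in
    if v ∈ S ∧ A.output (c.new v) = none then
      A.next (c.new v) {s | ∃ u, G.Adj v u ∧ A.write S c u = s}
    else c.new v

/-- The configuration at time `t`, that is, just before step `t` (steps are numbered from `0`). -/
def Algorithm.run (A : Algorithm Input) (G : SimpleGraph V) (ident : V → ℕ) (inp : Input)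
    (S : Scheduling V) : ℕ → Config A.State V
  | 0 => A.initial ident inp
  | t + 1 => A.step G (S t) (A.run G ident inp S t)

/-- In the execution given by the scheduling `S`, node `v` terminates with output `x`. -/
def Algorithm.Decides (A : Algorithm Input) (G : SimpleGraph V) (ident : V → ℕ) (inp : Input)
    (S : Scheduling V) (v : V) (x : ℕ) : Prop :=
  ∃ t, A.output ((A.run G ident inp S t).new v) = some x

/-- The runtime of `v`: the number of times that `v` is activated while it has not terminated. -/
def Algorithm.runtime (A : Algorithm Input) (G : SimpleGraph V) (ident : V → ℕ) (inp : Input)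
    (S : Scheduling V) (v : V) : ℕ∞ :=
  {t : ℕ | v ∈ S t ∧ A.output ((A.run G ident inp S t).new v) = none}.encard

/-- In the execution given by `S`, the outputs form a proper coloring, with colors in
`{0, …, k - 1}`, of the subgraph induced by the nodes that terminate. -/
def Algorithm.ProperlyColors (A : Algorithm Input) (G : SimpleGraph V) (ident : V → ℕ)
    (inp : Input) (S : Scheduling V) (k : ℕ) : Prop :=
  (∀ v x, A.Decides G ident inp S v x → x < k) ∧
  ∀ u v x y, G.Adj u v → A.Decides G ident inp S u x → A.Decides G ident inp S v y → x ≠ y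

/-- The iterated logarithm `log* n`: the number of times that the base-two logarithm must be applied,
starting from `n`, to reach a value at most `1`. -/
def logStar (n : ℕ) : ℕ := sInf {k : ℕ | (Real.logb 2)^[k] (n : ℝ) ≤ 1}

end AsyncLocal

end

set_option linter.unusedSectionVars false

noncomputable section

/-! The algorithm has two phases. The first is a Linial-type color reduction without waiting. In
round `i`, a node of color `x` sees the round-`i` colors of those neighbors that have computed one,
and picks a new color that is `good` for `x` and for none of the colors seen. If two neighbors both
have a color of round `i + 1`, the later of the two has seen the round-`i` color of the other,
because old colors are kept and a register lags at most one round behind. Its new color is not good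
for that color, whereas the new color of the other is, so they differ (`reduced`). Two reductions
lower the number of bits by one level of the tower of exponentials (`nextBits_nextBits_le`). Hence
`O(log* N)` reductions yield ranks below a bound depending only on `Δ`, distinct on adjacent nodes
that get that far.

In the second phase a node keeps a pair `(a, b)`, where `a` is the least value not used as first
component by a higher neighbor and `b` the least one not used as second component by a lower
neighbor. Then `a + b ≤ Δ`, which gives `(Δ + 1)(Δ + 2) / 2` colors. First components settle from
the highest rank downwards, second components from the lowest rank upwards. A node halts when no
visible neighbor has its color.

One color is saved by giving `(0, Δ)` the color of `(Δ, 0)`. Only local maxima and local minima with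
`Δ` neighbors could need these pairs, but such nodes might now chase each other forever. So they
follow special rules. A minimum takes the first free `(a, 0)`; it needs `(Δ, 0)` only if its
neighbors show every `(a, 0)` with `a < Δ`, once each. A maximum works at a level `c ∈ {0, 1}`, uses
`(c, Δ)` only if its neighbors occupy `(c, 1), …, (c, Δ - 1)`, and switches level when driven away
from `(c, Δ)`.

Such a conflict involves only two nodes: a maximum `u` at `(c, Δ)` has at most one neighboring
minimum (`isMin_unique`), and a minimum `v` that ever uses `(Δ, 0)` has at most one neighboring
maximum (`isMax_unique`). To choose `(Δ, 0)`, `v` must see at `u` the one first component missing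
among its other neighbors. Once `u` has switched, that missing value has to change before the
conflict recurs. The other neighbors take positive second components as soon as they move with `v`
visible, so this happens `O(Δ)` times (`changes_seenLevel`, `changes_fst_max`). The remaining counts
follow without circularity: components of ordinary nodes, visits of minima to `(Δ, 0)`, moves of
maxima, moves of minima (`changes_st_le`). -/

namespace AsyncLocal

/-! ### The least natural number outside a set -/

/-- The least natural number that does not belong to `A`. -/
def mex (A : Set ℕ) : ℕ := sInf Aᶜ

theorem mex_notMem {A : Set ℕ} (hA : A.Finite) : mex A ∉ A :=
  Nat.sInf_mem hA.infinite_compl.nonempty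

theorem mem_of_lt_mex {A : Set ℕ} {x : ℕ} (h : x < mex A) : x ∈ A := by
  by_contra hx
  exact Nat.notMem_of_lt_sInf h hx

theorem mex_le_card {A : Set ℕ} {B : Finset ℕ} (h : A ⊆ B) : mex A ≤ B.card := by
  have : Finset.range (mex A) ⊆ B := fun x hx =>
    h (mem_of_lt_mex (Finset.mem_range.mp hx))
  simpa using Finset.card_le_card this

theorem mex_eq {A : Set ℕ} {x : ℕ} (hx : x ∉ A) (h : ∀ y < x, y ∈ A) : mex A = x := by
  refine le_antisymm (Nat.sInf_le hx) (not_lt.mp fun hlt => ?_)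
  have : mex A ∉ A := Nat.sInf_mem (s := Aᶜ) ⟨x, hx⟩
  exact this (h _ hlt)

theorem mex_empty : mex ∅ = 0 := mex_eq (by simp) (by simp)

theorem mex_pos {A : Set ℕ} (hA : A.Finite) (h : 0 ∈ A) : 0 < mex A :=
  Nat.pos_of_ne_zero fun h0 => mex_notMem hA (h0 ▸ h)

/-! ### Counting the changes of a function of time -/

open Classical in
/-- The number of changes of `φ` before time `T`. -/
def changes {α : Type*} (φ : ℕ → α) (T : ℕ) : ℕ :=
  ((Finset.range T).filter fun t => φ t ≠ φ (t + 1)).card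

open Classical in
theorem changes_succ {α : Type*} (φ : ℕ → α) (T : ℕ) :
    changes φ (T + 1) = changes φ T + if φ T = φ (T + 1) then 0 else 1 := by
  unfold changes
  rw [Finset.range_add_one, Finset.filter_insert]
  split_ifs with h1 h2 <;> simp_all

@[simp] theorem changes_zero {α : Type*} (φ : ℕ → α) : changes φ 0 = 0 := by simp [changes]

open Classical in
theorem changes_shift {α : Type*} (φ : ℕ → α) (T : ℕ) :
    changes (fun t => φ (t + 1)) T ≤ changes φ (T + 1) := by
  induction T with
  | zero => simp
  | succ T ih =>
    rw [changes_succ, changes_succ φ (T + 1)]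
    omega

open Classical in
/-- A function that samples `φ` at some times does not change more often than `φ`. -/
theorem changes_sample {α : Type*} {φ ψ : ℕ → α} (h0 : ψ 0 = φ 0)
    (h : ∀ t, ψ (t + 1) = ψ t ∨ ψ (t + 1) = φ t) (T : ℕ) : changes ψ T ≤ changes φ T := by
  -- A change of `φ` that `ψ` has not copied yet is kept as a credit of one.
  have : changes ψ T + (if ψ T = φ T then 0 else 1) ≤ changes φ T := by
    induction T with
    | zero => simp [h0]
    | succ T ih =>
      rw [changes_succ, changes_succ φ]
      rcases h T with h | h <;> rw [h] <;> split_ifs at * <;> simp_all <;> omega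
  omega

open Classical in
-- Without a common initial value the first copy may be a change of its own, hence the extra one.
-- Typically `ψ` is the pair of a node and `φ` the pair that the rule would give at each step.
theorem changes_update {α : Type*} {φ ψ : ℕ → α}
    (h : ∀ t, ψ (t + 1) = ψ t ∨ ψ (t + 1) = φ t) (T : ℕ) : changes ψ T ≤ changes φ T + 1 := by
  have : changes ψ T + (if ψ T = φ T then 0 else 1) ≤ changes φ T + 1 := by
    induction T with
    | zero => split_ifs <;> simp
    | succ T ih =>
      rw [changes_succ, changes_succ φ]
      rcases h T with h | h <;> rw [h] <;> split_ifs at * <;> simp_all <;> omega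
  omega

open Classical in
theorem changes_le_sum {α ι : Type*} {β : ι → Type*} (φ : ℕ → α) (I : Finset ι)
    (ψ : ∀ i, ℕ → β i) (h : ∀ t, φ t ≠ φ (t + 1) → ∃ i ∈ I, ψ i t ≠ ψ i (t + 1)) (T : ℕ) :
    changes φ T ≤ ∑ i ∈ I, changes (ψ i) T := by
  refine le_trans (Finset.card_le_card ?_) Finset.card_biUnion_le
  intro t ht
  simp only [Finset.mem_filter, Finset.mem_biUnion] at *
  obtain ⟨i, hi, h'⟩ := h t ht.2
  exact ⟨i, hi, ht.1, h'⟩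

open Classical in
theorem changes_le_add {α β γ : Type*} (φ : ℕ → α) (ψ : ℕ → β) (χ : ℕ → γ)
    (h : ∀ t, φ t ≠ φ (t + 1) → ψ t ≠ ψ (t + 1) ∨ χ t ≠ χ (t + 1)) (T : ℕ) :
    changes φ T ≤ changes ψ T + changes χ T := by
  refine le_trans (Finset.card_le_card ?_) (Finset.card_union_le _ _)
  intro t ht
  simp only [Finset.mem_filter, Finset.mem_union] at *
  rcases h t ht.2 with h | h
  · exact Or.inl ⟨ht.1, h⟩
  · exact Or.inr ⟨ht.1, h⟩

open Classical in
/-- A property that changes only once. -/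
theorem changes_le_one_of_monotone {φ : ℕ → Prop} (h : ∀ t, φ t → φ (t + 1)) (T : ℕ) :
    changes φ T ≤ 1 := by
  have : changes φ T + (if φ T then 0 else 1) ≤ 1 := by
    induction T with
    | zero => split_ifs <;> simp
    | succ T ih =>
      have := h T
      rw [changes_succ]
      by_cases h1 : φ T <;> by_cases h2 : φ (T + 1) <;> simp_all
  omega

theorem card_le_changes {α : Type*} {φ : ℕ → α} {T : ℕ} {S : Finset ℕ}
    (h : ∀ t ∈ S, t < T ∧ φ t ≠ φ (t + 1)) : S.card ≤ changes φ T := by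
  classical
  refine Finset.card_le_card fun t ht => ?_
  simp only [Finset.mem_filter, Finset.mem_range]
  exact h t ht

open Classical in
/-- The changes of a property are controlled by the number of times that it stops holding. -/
theorem changes_le_of_off {φ : ℕ → Prop} {T C : ℕ}
    (h : ∀ S : Finset ℕ, (∀ t ∈ S, t < T ∧ φ t ∧ ¬ φ (t + 1)) → S.card ≤ C) :
    changes φ T ≤ 2 * C + 1 := by
  have h1 := h ((Finset.range T).filter fun t => φ t ∧ ¬ φ (t + 1)) fun t ht => by
    simpa using ht
  -- Switches on and off alternate; the last term accounts for a switch on that is not yet followed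
  -- by a switch off.
  have : changes φ T ≤ 2 * ((Finset.range T).filter fun t => φ t ∧ ¬ φ (t + 1)).card +
      if φ T then 1 else 0 := by
    clear h h1
    induction T with
    | zero => simp
    | succ T ih =>
      rw [changes_succ, Finset.range_add_one, Finset.filter_insert]
      by_cases h1 : φ T <;> by_cases h2 : φ (T + 1) <;> simp_all
      omega
  split_ifs at this <;> omega

open Classical in
/-- If `α` can leave a value only when it agrees with `l`, then `α` does not change much more often
than `l`. -/
theorem changes_le_of_leave {α : ℕ → Option ℕ} {l : ℕ → ℕ}
    (hn : ∀ t, α t ≠ none → α (t + 1) ≠ none)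
    (h : ∀ t, α t ≠ α (t + 1) → α t = none ∨ α t = some (l t)) (T : ℕ) :
    changes α T ≤ changes l T + 2 := by
  -- After leaving a value, `α` disagrees with `l`, so `l` must change before `α` can leave again.
  -- The potential is `1` while `α` agrees with `l` and may leave; it is `2` at `none`, to pay for
  -- the first choice and for a possible agreement just after it.
  have : changes α T + (if α T = none then 2 else if α T = some (l T) then 1 else 0)
      ≤ changes l T + 2 := by
    induction T with
    | zero => split_ifs <;> simp
    | succ T ih =>
      have h1 := hn T
      have h2 := h T
      rw [changes_succ, changes_succ l]
      by_cases ha : α T = none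
      · simp only [ha, if_true] at ih
        rw [ha]
        rcases h5 : α (T + 1) with _ | x
        · simp only [if_true]; omega
        · simp only [reduceCtorEq, if_false]
          split_ifs <;> omega
      · have h3 := h1 ha
        simp only [ha, h3, if_false] at ih ⊢
        by_cases hc : α T = α (T + 1)
        · rw [← hc]
          by_cases hl : l T = l (T + 1)
          · rw [← hl]; simpa using ih
          · simp only [hl, if_false, if_true]
            split_ifs at * <;> omega
        · have h4 : α T = some (l T) := (h2 hc).resolve_left ha
          simp only [h4, if_true] at ih
          rw [h4] at hc
          by_cases hl : l T = l (T + 1)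
          · rw [← hl, h4]
            simp only [hc, Ne.symm hc, if_false, if_true]
            omega
          · rw [h4]
            simp only [hl, hc, if_false]
            split_ifs <;> omega
  omega

/-! ### The rule that chooses a pair -/

/-- What a node sees of a neighbor that has chosen a pair. -/
structure Peer where
  ident : ℕ
  rank : ℕ
  pair : ℕ × ℕ

/-- The color that a pair stands for: all pairs `(c, Δ)` stand for the same color as `(Δ, 0)`. -/
def pairColor (Δ : ℕ) (p : ℕ × ℕ) : ℕ × ℕ := if p.2 = Δ then (Δ, 0) else p

/-- The first component that a local maximum uses for its next pair. -/
def level (Δ : ℕ) : Option (ℕ × ℕ) → ℕ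
  | none => 0
  | some p => if p.2 = Δ then 1 - p.1 else p.1

open Classical in
/-- The new pair of a node of rank `x`, with current pair `own`, that sees the peers in `Q`. -/
def newPair (Δ x : ℕ) (own : Option (ℕ × ℕ)) (Q : Set Peer) : ℕ × ℕ :=
  if Q.ncard = Δ ∧ ∀ q ∈ Q, x < q.rank then (mex {a | ∃ q ∈ Q, q.pair = (a, 0)}, 0)
  else if Q.ncard = Δ ∧ ∀ q ∈ Q, q.rank < x then
    -- Excluding `0` reserves the second component `0` for the case of a full level.
    if mex ({0} ∪ {b | ∃ q ∈ Q, q.pair = (level Δ own, b)}) < Δ then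
      (level Δ own, mex ({0} ∪ {b | ∃ q ∈ Q, q.pair = (level Δ own, b)}))
    -- The level is full, so at most one neighbor does not occupy one of `(c, 1), …, (c, Δ - 1)`. If
    -- a neighbor has first component `Δ`, it is that one, and `(c, 0)` is free.
    else if ∃ q ∈ Q, q.pair.1 = Δ then (level Δ own, 0) else (level Δ own, Δ)
  else (mex {a | ∃ q ∈ Q, x < q.rank ∧ q.pair.1 = a}, mex {b | ∃ q ∈ Q, q.rank < x ∧ q.pair.2 = b})

section Rule

variable {V : Type} [Fintype V]

open Classical in
/-- The neighbors of `v`. -/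
def nb (G : SimpleGraph V) (v : V) : Finset V := Finset.univ.filter (G.Adj v)

@[simp] theorem mem_nb {G : SimpleGraph V} {v w : V} : w ∈ nb G v ↔ G.Adj v w := by simp [nb]

/-- The peers that `v` sees when the registers contain the pairs `R`. -/
def peers (G : SimpleGraph V) (X ident : V → ℕ) (R : V → Option (ℕ × ℕ)) (v : V) : Set Peer :=
  {q | ∃ w p, G.Adj v w ∧ R w = some p ∧ q = ⟨ident w, X w, p⟩}

/-- All neighbors of `v` have a pair in their register. -/
def Full (G : SimpleGraph V) (R : V → Option (ℕ × ℕ)) (v : V) : Prop := ∀ w, G.Adj v w → R w ≠ none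

/-- `v` has `Δ` neighbors, of higher rank. -/
def IsMin (G : SimpleGraph V) (X : V → ℕ) (Δ : ℕ) (v : V) : Prop :=
  (nb G v).card = Δ ∧ ∀ w, G.Adj v w → X v < X w

/-- `v` has `Δ` neighbors, of lower rank. -/
def IsMax (G : SimpleGraph V) (X : V → ℕ) (Δ : ℕ) (v : V) : Prop :=
  (nb G v).card = Δ ∧ ∀ w, G.Adj v w → X w < X v

/-- The pairs that `w` can hold. -/
structure Valid (G : SimpleGraph V) (X : V → ℕ) (Δ : ℕ) (w : V) (p : ℕ × ℕ) : Prop where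
  snd_of_min : IsMin G X Δ w → p.2 = 0
  fst_of_not_min : ¬ IsMin G X Δ w → p.1 < Δ
  fst_of_max : IsMax G X Δ w → p.1 ≤ 1
  snd_of_not_max : ¬ IsMax G X Δ w → p.2 < Δ
  sum_le : p.2 = Δ ∨ p.1 + p.2 ≤ Δ

/-- The standing assumptions on the graph, the ranks and the identifiers. -/
structure Ranked (G : SimpleGraph V) (X ident : V → ℕ) (Δ : ℕ) : Prop where
  two_le : 2 ≤ Δ
  card_le : ∀ v, (nb G v).card ≤ Δ
  inj : Function.Injective ident
  proper : ∀ u v, G.Adj u v → X u ≠ X v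

variable {G : SimpleGraph V} {X ident : V → ℕ} {Δ : ℕ} {R : V → Option (ℕ × ℕ)} {v : V}

/-! ### Local extrema and the branches of the rule -/

theorem IsMax.not_isMin (hG : Ranked G X ident Δ) (h : IsMax G X Δ v) : ¬ IsMin G X Δ v := by
  intro h'
  have : (nb G v).card ≠ 0 := by have := h.1; have := hG.two_le; omega
  obtain ⟨w, hw⟩ := Finset.card_ne_zero.mp this
  rw [mem_nb] at hw
  exact absurd (h.2 w hw) (h'.2 w hw).le.not_gt

theorem IsMax.not_isMax_adj (h : IsMax G X Δ v) {w : V} (hw : G.Adj v w) : ¬ IsMax G X Δ w :=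
  fun h' => absurd (h.2 w hw) (h'.2 v hw.symm).le.not_gt

theorem IsMin.not_isMin_adj (h : IsMin G X Δ v) {w : V} (hw : G.Adj v w) : ¬ IsMin G X Δ w :=
  fun h' => absurd (h.2 w hw) (h'.2 v hw.symm).le.not_gt

open Classical in
-- A node reads a set of register contents, without multiplicities. Since identifiers are distinct,
-- it can still count its visible neighbors.
theorem peers_ncard (hG : Ranked G X ident Δ) :
    (peers G X ident R v).ncard = ((nb G v).filter fun w => R w ≠ none).card := by
  have : peers G X ident R v =
      (fun w => (⟨ident w, X w, (R w).getD (0, 0)⟩ : Peer)) ''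
        ((nb G v).filter fun w => R w ≠ none : Finset V) := by
    ext q
    simp only [peers, Set.mem_ofPred_eq, Set.mem_image, Finset.coe_filter, mem_nb]
    constructor
    · rintro ⟨w, p, h1, h2, rfl⟩
      exact ⟨w, ⟨h1, by simp [h2]⟩, by simp [h2]⟩
    · rintro ⟨w, ⟨h1, h2⟩, rfl⟩
      obtain ⟨p, hp⟩ := Option.ne_none_iff_exists'.mp h2
      exact ⟨w, p, h1, hp, by simp [hp]⟩
  rw [this, Set.InjOn.ncard_image, Set.ncard_coe_finset]
  intro w _ w' _ h
  exact hG.inj (congrArg Peer.ident h)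

/-- A node does not know its degree. It can be certain that all its neighbors are visible only when
it counts `Δ` of them, which is why local extrema are required to have exactly `Δ` neighbors. -/
theorem peers_ncard_eq_iff (hG : Ranked G X ident Δ) :
    (peers G X ident R v).ncard = Δ ↔ (nb G v).card = Δ ∧ Full G R v := by
  classical
  rw [peers_ncard hG]
  have h1 := hG.card_le v
  have h2 := Finset.card_filter_le (nb G v) fun w => R w ≠ none
  constructor
  · intro h
    have h3 : ((nb G v).filter fun w => R w ≠ none) = nb G v :=
      Finset.eq_of_subset_of_card_le (Finset.filter_subset _ _) (by omega)
    refine ⟨by omega, fun w hw => ?_⟩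
    have : w ∈ (nb G v).filter fun w => R w ≠ none := by rw [h3]; simpa using hw
    exact (Finset.mem_filter.mp this).2
  · rintro ⟨h, hf⟩
    rw [Finset.filter_true_of_mem, h]
    intro w hw
    exact hf w (mem_nb.mp hw)

theorem min_cond_iff (hG : Ranked G X ident Δ) :
    ((peers G X ident R v).ncard = Δ ∧ ∀ q ∈ peers G X ident R v, X v < q.rank) ↔
      IsMin G X Δ v ∧ Full G R v := by
  rw [peers_ncard_eq_iff hG]
  constructor
  · rintro ⟨⟨h1, h2⟩, h3⟩
    refine ⟨⟨h1, fun w hw => ?_⟩, h2⟩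
    obtain ⟨p, hp⟩ := Option.ne_none_iff_exists'.mp (h2 w hw)
    exact h3 _ ⟨w, p, hw, hp, rfl⟩
  · rintro ⟨h1, h2⟩
    refine ⟨⟨h1.1, h2⟩, ?_⟩
    rintro _ ⟨w, p, hw, hp, rfl⟩
    exact h1.2 w hw

theorem max_cond_iff (hG : Ranked G X ident Δ) :
    ((peers G X ident R v).ncard = Δ ∧ ∀ q ∈ peers G X ident R v, q.rank < X v) ↔
      IsMax G X Δ v ∧ Full G R v := by
  rw [peers_ncard_eq_iff hG]
  constructor
  · rintro ⟨⟨h1, h2⟩, h3⟩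
    refine ⟨⟨h1, fun w hw => ?_⟩, h2⟩
    obtain ⟨p, hp⟩ := Option.ne_none_iff_exists'.mp (h2 w hw)
    exact h3 _ ⟨w, p, hw, hp, rfl⟩
  · rintro ⟨h1, h2⟩
    refine ⟨⟨h1.1, h2⟩, ?_⟩
    rintro _ ⟨w, p, hw, hp, rfl⟩
    exact h1.2 w hw

theorem exists_mem_peers {P : Peer → Prop} :
    (∃ q ∈ peers G X ident R v, P q) ↔ ∃ w p, G.Adj v w ∧ R w = some p ∧ P ⟨ident w, X w, p⟩ := by
  constructor
  · rintro ⟨_, ⟨w, p, hw, hp, rfl⟩, h⟩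
    exact ⟨w, p, hw, hp, h⟩
  · rintro ⟨w, p, hw, hp, h⟩
    exact ⟨_, ⟨w, p, hw, hp, rfl⟩, h⟩

/-- The new pair of `v` when the registers contain the pairs `R`. -/
abbrev nextPair (G : SimpleGraph V) (X ident : V → ℕ) (Δ : ℕ) (own : Option (ℕ × ℕ))
    (R : V → Option (ℕ × ℕ)) (v : V) : ℕ × ℕ :=
  newPair Δ (X v) own (peers G X ident R v)

/-- The first components of the neighbors whose second component is `0`. -/
def minSet (G : SimpleGraph V) (R : V → Option (ℕ × ℕ)) (v : V) : Set ℕ :=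
  {a | ∃ w, G.Adj v w ∧ R w = some (a, 0)}

/-- The second components of the neighbors whose first component is `c`. -/
def maxSet (G : SimpleGraph V) (R : V → Option (ℕ × ℕ)) (v : V) (c : ℕ) : Set ℕ :=
  {0} ∪ {b | ∃ w, G.Adj v w ∧ R w = some (c, b)}

/-- The first components of the higher neighbors. -/
def upSet (G : SimpleGraph V) (X : V → ℕ) (R : V → Option (ℕ × ℕ)) (v : V) : Set ℕ :=
  {a | ∃ w b, G.Adj v w ∧ X v < X w ∧ R w = some (a, b)}

/-- The second components of the lower neighbors. -/
def downSet (G : SimpleGraph V) (X : V → ℕ) (R : V → Option (ℕ × ℕ)) (v : V) : Set ℕ :=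
  {b | ∃ w a, G.Adj v w ∧ X w < X v ∧ R w = some (a, b)}

theorem nextPair_min (hG : Ranked G X ident Δ) (h : IsMin G X Δ v) (hf : Full G R v)
    (own : Option (ℕ × ℕ)) : nextPair G X ident Δ own R v = (mex (minSet G R v), 0) := by
  unfold nextPair newPair
  rw [if_pos ((min_cond_iff hG).mpr ⟨h, hf⟩)]
  congr 2
  ext a
  simp only [Set.mem_ofPred_eq, exists_mem_peers, minSet]
  constructor
  · rintro ⟨w, p, hw, hp, rfl⟩
    exact ⟨w, hw, hp⟩
  · rintro ⟨w, hw, hp⟩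
    exact ⟨w, _, hw, hp, rfl⟩

open Classical in
theorem nextPair_max (hG : Ranked G X ident Δ) (h : IsMax G X Δ v) (hf : Full G R v)
    (own : Option (ℕ × ℕ)) : nextPair G X ident Δ own R v =
      if mex (maxSet G R v (level Δ own)) < Δ then
        (level Δ own, mex (maxSet G R v (level Δ own)))
      else if ∃ w p, G.Adj v w ∧ R w = some p ∧ p.1 = Δ then (level Δ own, 0)
      else (level Δ own, Δ) := by
  have hs : ({0} ∪ {b | ∃ q ∈ peers G X ident R v, q.pair = (level Δ own, b)}) =
      maxSet G R v (level Δ own) := by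
    ext b
    simp only [Set.mem_union, Set.mem_ofPred_eq, exists_mem_peers, maxSet]
    constructor
    · rintro (h | ⟨w, p, hw, hp, rfl⟩)
      · exact Or.inl h
      · exact Or.inr ⟨w, hw, hp⟩
    · rintro (h | ⟨w, hw, hp⟩)
      · exact Or.inl h
      · exact Or.inr ⟨w, _, hw, hp, rfl⟩
  unfold nextPair newPair
  rw [if_neg (fun h' => h.not_isMin hG ((min_cond_iff hG).mp h').1),
    if_pos ((max_cond_iff hG).mpr ⟨h, hf⟩), hs]
  simp only [exists_mem_peers]

theorem nextPair_other (hG : Ranked G X ident Δ) (h1 : ¬ (IsMin G X Δ v ∧ Full G R v))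
    (h2 : ¬ (IsMax G X Δ v ∧ Full G R v)) (own : Option (ℕ × ℕ)) :
    nextPair G X ident Δ own R v = (mex (upSet G X R v), mex (downSet G X R v)) := by
  unfold nextPair newPair
  rw [if_neg (mt (min_cond_iff hG).mp h1), if_neg (mt (max_cond_iff hG).mp h2)]
  congr 2
  · ext a
    simp only [Set.mem_ofPred_eq, exists_mem_peers, upSet]
    constructor
    · rintro ⟨w, p, hw, hp, h, rfl⟩
      exact ⟨w, p.2, hw, h, hp⟩
    · rintro ⟨w, b, hw, h, hp⟩
      exact ⟨w, _, hw, hp, h, rfl⟩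
  · ext b
    simp only [Set.mem_ofPred_eq, exists_mem_peers, downSet]
    constructor
    · rintro ⟨w, p, hw, hp, h, rfl⟩
      exact ⟨w, p.1, hw, h, hp⟩
    · rintro ⟨w, b, hw, h, hp⟩
      exact ⟨w, _, hw, hp, h, rfl⟩

/-- Counting visible higher neighbors here and visible lower neighbors in `downSet_subset` makes the
two bounds add up to at most the degree. The filter ensures that the default `(0, 0)` is never used.
-/
theorem upSet_subset [DecidableEq V] [DecidablePred fun w => R w ≠ none ∧ X v < X w] :
    upSet G X R v ⊆ ((nb G v).filter fun w => R w ≠ none ∧ X v < X w).image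
      fun w => ((R w).getD (0, 0)).1 := by
  rintro a ⟨w, b, hw, h, hp⟩
  simp only [Finset.coe_image, Set.mem_image, Finset.coe_filter, Set.mem_ofPred_eq, mem_nb]
  exact ⟨w, ⟨hw, by simp [hp], h⟩, by simp [hp]⟩

theorem downSet_subset [DecidableEq V] [DecidablePred fun w => R w ≠ none ∧ X w < X v] :
    downSet G X R v ⊆ ((nb G v).filter fun w => R w ≠ none ∧ X w < X v).image
      fun w => ((R w).getD (0, 0)).2 := by
  rintro a ⟨w, b, hw, h, hp⟩
  simp only [Finset.coe_image, Set.mem_image, Finset.coe_filter, Set.mem_ofPred_eq, mem_nb]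
  exact ⟨w, ⟨hw, by simp [hp], h⟩, by simp [hp]⟩

theorem upSet_finite : (upSet G X R v).Finite := by
  classical exact (Finset.finite_toSet _).subset upSet_subset

theorem downSet_finite : (downSet G X R v).Finite := by
  classical exact (Finset.finite_toSet _).subset downSet_subset

theorem minSet_finite : (minSet G R v).Finite := by
  refine ((nb G v).finite_toSet.image fun w => ((R w).getD (0, 0)).1).subset ?_
  rintro a ⟨w, hw, hp⟩
  exact ⟨w, by simpa using hw, by simp [hp]⟩

theorem maxSet_finite {c : ℕ} : (maxSet G R v c).Finite := by
  refine (Set.finite_singleton 0).union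
    (((nb G v).finite_toSet.image fun w => ((R w).getD (0, 0)).2).subset ?_)
  rintro a ⟨w, hw, hp⟩
  exact ⟨w, by simpa using hw, by simp [hp]⟩

theorem mex_minSet_le (hG : Ranked G X ident Δ) : mex (minSet G R v) ≤ Δ := by
  classical
  refine (mex_le_card (B := (nb G v).image fun w => ((R w).getD (0, 0)).1) ?_).trans
    (Finset.card_image_le.trans (hG.card_le v))
  rintro a ⟨w, hw, hp⟩
  simp only [Finset.coe_image, Set.mem_image, Finset.mem_coe, mem_nb]
  exact ⟨w, hw, by simp [hp]⟩

/-- Local extrema apart, the pairs of the general rule satisfy the required bounds. -/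
theorem general_pair_bounds (hG : Ranked G X ident Δ) (h1 : ¬ (IsMin G X Δ v ∧ Full G R v))
    (h2 : ¬ (IsMax G X Δ v ∧ Full G R v)) :
    mex (upSet G X R v) < Δ ∧ mex (downSet G X R v) < Δ ∧
      mex (upSet G X R v) + mex (downSet G X R v) ≤ Δ := by
  classical
  set A := (nb G v).filter fun w => R w ≠ none ∧ X v < X w with hA
  set B := (nb G v).filter fun w => R w ≠ none ∧ X w < X v with hB
  have ha : mex (upSet G X R v) ≤ A.card := (mex_le_card upSet_subset).trans Finset.card_image_le
  have hb : mex (downSet G X R v) ≤ B.card :=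
    (mex_le_card downSet_subset).trans Finset.card_image_le
  have hd : Disjoint A B := Finset.disjoint_filter.mpr fun w _ h h' => by omega
  have hAB : A.card + B.card ≤ (nb G v).card := by
    rw [← Finset.card_union_of_disjoint hd]
    exact Finset.card_le_card
      (Finset.union_subset (Finset.filter_subset _ _) (Finset.filter_subset _ _))
  have hc := hG.card_le v
  have key : ∀ S : Finset V, S ⊆ nb G v → S.card = Δ → S = nb G v ∧ (nb G v).card = Δ := by
    intro S hS hS'
    exact ⟨Finset.eq_of_subset_of_card_le hS (by omega),
      le_antisymm hc (hS' ▸ Finset.card_le_card hS)⟩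
  -- A component can reach `Δ` only if `Δ` neighbors are visible and all on the same side; that is
  -- the situation of a local extremum with a full view.
  have hA' : A.card ≠ Δ := fun h => by
    obtain ⟨h3, h4⟩ := key A (Finset.filter_subset _ _) h
    have h5 : ∀ w, G.Adj v w → R w ≠ none ∧ X v < X w := fun w hw =>
      (Finset.mem_filter.mp (h3 ▸ mem_nb.mpr hw : w ∈ A)).2
    exact h1 ⟨⟨h4, fun w hw => (h5 w hw).2⟩, fun w hw => (h5 w hw).1⟩
  have hB' : B.card ≠ Δ := fun h => by
    obtain ⟨h3, h4⟩ := key B (Finset.filter_subset _ _) h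
    have h5 : ∀ w, G.Adj v w → R w ≠ none ∧ X w < X v := fun w hw =>
      (Finset.mem_filter.mp (h3 ▸ mem_nb.mpr hw : w ∈ B)).2
    exact h2 ⟨⟨h4, fun w hw => (h5 w hw).2⟩, fun w hw => (h5 w hw).1⟩
  omega

theorem upSet_eq_empty (h : IsMax G X Δ v) : upSet G X R v = ∅ := by
  ext a
  simp only [upSet, Set.mem_ofPred_eq, Set.mem_empty_iff_false, iff_false]
  rintro ⟨w, b, hw, h', -⟩
  exact absurd (h.2 w hw) h'.le.not_gt

theorem downSet_eq_empty (h : IsMin G X Δ v) : downSet G X R v = ∅ := by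
  ext a
  simp only [downSet, Set.mem_ofPred_eq, Set.mem_empty_iff_false, iff_false]
  rintro ⟨w, b, hw, h', -⟩
  exact absurd (h.2 w hw) h'.le.not_gt

/-- Only the levels `0` and `1` occur, so a pair `(c, b)` of a maximum with `b < Δ` still satisfies
`c + b ≤ Δ`. -/
theorem level_le_one (h : IsMax G X Δ v) {own : Option (ℕ × ℕ)}
    (ho : ∀ p, own = some p → Valid G X Δ v p) : level Δ own ≤ 1 := by
  rcases own with _ | p
  · simp [level]
  · have := (ho p rfl).fst_of_max h
    simp only [level]
    split_ifs <;> omega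

/-- This invariant confines the colors to the palette: a pair either has sum at most `Δ`, or is some
`(c, Δ)` and shares the color of `(Δ, 0)`. Until its view is full, a local extremum follows the
general rule, and one of its components is then the mex of the empty set. -/
theorem nextPair_valid (hG : Ranked G X ident Δ) {own : Option (ℕ × ℕ)}
    (ho : ∀ p, own = some p → Valid G X Δ v p) :
    Valid G X Δ v (nextPair G X ident Δ own R v) := by
  have hΔ := hG.two_le
  by_cases h1 : IsMin G X Δ v ∧ Full G R v
  · rw [nextPair_min hG h1.1 h1.2]
    have := mex_minSet_le hG (R := R) (v := v)
    exact ⟨fun _ => rfl, fun h => absurd h1.1 h, fun h => absurd h1.1 (h.not_isMin hG),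
      fun _ => by simp; omega, Or.inr (by simpa using this)⟩
  by_cases h2 : IsMax G X Δ v ∧ Full G R v
  · have hl := level_le_one h2.1 ho
    rw [nextPair_max hG h2.1 h2.2]
    have hn := h2.1.not_isMin hG
    split_ifs with h3 h4
    · exact ⟨fun h => absurd h hn, fun _ => by simp; omega, fun _ => hl, fun h => absurd h2.1 h,
        Or.inr (by simp; omega)⟩
    · exact ⟨fun h => absurd h hn, fun _ => by simp; omega, fun _ => hl, fun h => absurd h2.1 h,
        Or.inr (by simp; omega)⟩
    · exact ⟨fun h => absurd h hn, fun _ => by simp; omega, fun _ => hl, fun h => absurd h2.1 h,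
        Or.inl rfl⟩
  rw [nextPair_other hG h1 h2]
  obtain ⟨ha, hb, hab⟩ := general_pair_bounds hG h1 h2
  refine ⟨fun h => ?_, fun _ => ha, fun h => ?_, fun _ => hb, Or.inr hab⟩
  · simp [downSet_eq_empty h, mex_empty]
  · simp [upSet_eq_empty h, mex_empty]

/-- When level `c` is full at `v`, at most one neighbor does not contribute to that. -/
theorem unique_of_full_level (hG : Ranked G X ident Δ) {c : ℕ} (h : Δ ≤ mex (maxSet G R v c))
    {w w' : V} (hw : G.Adj v w) (hw' : G.Adj v w') (h1 : ∀ b, R w = some (c, b) → b = 0)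
    (h2 : ∀ b, R w' = some (c, b) → b = 0) : w = w' := by
  classical
  by_contra hne
  -- Each of the `Δ - 1` values is used at level `c` by a neighbor other than `w` and `w'`, but
  -- there are at most `Δ - 2` such neighbors.
  have hsub : Finset.Icc 1 (Δ - 1) ⊆
      (((nb G v).erase w).erase w').image fun w => ((R w).getD (0, 0)).2 := by
    intro j hj
    have hj := Finset.mem_Icc.mp hj
    have hm : j ∈ maxSet G R v c := mem_of_lt_mex (by have := hG.two_le; omega)
    rcases hm with hm | ⟨z, hz, hz'⟩
    · simp only [Set.mem_singleton_iff] at hm; omega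
    · refine Finset.mem_image.mpr ⟨z, ?_, by simp [hz']⟩
      refine Finset.mem_erase.mpr ⟨?_, Finset.mem_erase.mpr ⟨?_, mem_nb.mpr hz⟩⟩
      · rintro rfl; have := h2 _ hz'; omega
      · rintro rfl; have := h1 _ hz'; omega
  have h3 := (Finset.card_le_card hsub).trans Finset.card_image_le
  rw [Finset.card_erase_of_mem (Finset.mem_erase.mpr ⟨Ne.symm hne, mem_nb.mpr hw'⟩),
    Finset.card_erase_of_mem (mem_nb.mpr hw)] at h3
  have := hG.card_le v
  have := hG.two_le
  simp only [Nat.card_Icc] at h3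
  omega

/-- When a local minimum must use `(Δ, 0)`, its neighbors use all the pairs `(a, 0)` with `a < Δ`. -/
theorem forall_of_mex_minSet (hG : Ranked G X ident Δ) (h : mex (minSet G R v) = Δ) :
    (∀ w, G.Adj v w → ∃ a < Δ, R w = some (a, 0)) ∧
    (∀ w w' a, G.Adj v w → G.Adj v w' → R w = some (a, 0) → R w' = some (a, 0) → w = w') := by
  classical
  set S := (nb G v).filter fun w => ∃ a < Δ, R w = some (a, 0) with hS
  set f : V → ℕ := fun w => ((R w).getD (0, 0)).1 with hf
  have hsub : Finset.range Δ ⊆ S.image f := by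
    intro a ha
    have ha := Finset.mem_range.mp ha
    obtain ⟨w, hw, hp⟩ : a ∈ minSet G R v := mem_of_lt_mex (by omega)
    exact Finset.mem_image.mpr ⟨w, Finset.mem_filter.mpr ⟨mem_nb.mpr hw, a, ha, hp⟩,
      by simp [hf, hp]⟩
  have h1 := Finset.card_le_card hsub
  rw [Finset.card_range] at h1
  have h2 : (S.image f).card ≤ S.card := Finset.card_image_le
  have h3 : S.card ≤ (nb G v).card := Finset.card_filter_le _ _
  have h4 := hG.card_le v
  have hSn : S = nb G v := Finset.eq_of_subset_of_card_le (Finset.filter_subset _ _) (by omega)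
  have hinj : Set.InjOn f S := Finset.card_image_iff.mp (by omega)
  refine ⟨fun w hw => ?_, fun w w' a hw hw' hp hp' => ?_⟩
  · have : w ∈ S := hSn ▸ mem_nb.mpr hw
    exact (Finset.mem_filter.mp this).2
  · refine hinj (Finset.mem_coe.mpr (hSn ▸ mem_nb.mpr hw))
      (Finset.mem_coe.mpr (hSn ▸ mem_nb.mpr hw')) ?_
    simp [hf, hp, hp']

/-- The new pair has a color that `v` does not see. -/
theorem nextPair_avoids (hG : Ranked G X ident Δ) {own : Option (ℕ × ℕ)}
    (ho : ∀ p, own = some p → Valid G X Δ v p)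
    (hR : ∀ w p, R w = some p → Valid G X Δ w p) {w : V} {p : ℕ × ℕ} (hw : G.Adj v w)
    (hp : R w = some p) : pairColor Δ p ≠ pairColor Δ (nextPair G X ident Δ own R v) := by
  have hΔ := hG.two_le
  have hv := hR w p hp
  obtain ⟨a, b⟩ := p
  by_cases h1 : IsMin G X Δ v ∧ Full G R v
  · rw [nextPair_min hG h1.1 h1.2]
    have hwn := h1.1.not_isMin_adj hw
    have ha := hv.fst_of_not_min hwn
    have hmex := mex_notMem (minSet_finite (G := G) (R := R) (v := v))
    simp only [pairColor, show (0 : ℕ) ≠ Δ by omega, if_false] at *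
    split_ifs with hb
    -- The neighbor has the merged color. The minimum cannot be choosing `(Δ, 0)`, as this would
    -- require second component `0` at every neighbor.
    · subst hb
      intro h
      have hm : mex (minSet G R v) = b := (congrArg Prod.fst h).symm
      obtain ⟨a', -, h'⟩ := (forall_of_mex_minSet hG hm).1 w hw
      rw [hp] at h'
      simp at h'
      omega
    · intro h
      simp only [Prod.mk.injEq] at h
      exact hmex ⟨w, hw, by rw [← h.1, hp, h.2]⟩
  by_cases h2 : IsMax G X Δ v ∧ Full G R v
  · have hl := level_le_one h2.1 ho
    rw [nextPair_max hG h2.1 h2.2]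
    have hb := hv.snd_of_not_max (h2.1.not_isMax_adj hw)
    have hmex := mex_notMem (maxSet_finite (G := G) (R := R) (v := v) (c := level Δ own))
    have hc : pairColor Δ (a, b) = (a, b) := if_neg (by simpa using hb.ne)
    rw [hc]
    split_ifs with h3 h4
    · simp only [pairColor, h3.ne, if_false, ne_eq, Prod.mk.injEq, not_and]
      rintro rfl rfl
      exact hmex (Or.inr ⟨w, hw, hp⟩)
    -- A neighbor `w` at `(c, 0)` and a neighbor `z` with first component `Δ` would be two neighbors
    -- that do not fill level `c`; so they coincide, which `c ≤ 1 < Δ` excludes.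
    · simp only [pairColor, show (0 : ℕ) ≠ Δ by omega, if_false, ne_eq, Prod.mk.injEq, not_and]
      rintro rfl rfl
      obtain ⟨z, q, hz, hq, hq1⟩ := h4
      have : w = z := unique_of_full_level hG (not_lt.mp h3) hw hz
        (fun b hb => by rw [hp] at hb; simp at hb; exact hb.symm)
        (fun b hb => by rw [hq] at hb; simp at hb; rw [hb] at hq1; simp at hq1; omega)
      subst this
      rw [hp] at hq
      simp only [Option.some.injEq] at hq
      subst hq
      simp at hq1
      omega
    · simp only [pairColor, if_true, ne_eq, Prod.mk.injEq, not_and]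
      rintro rfl rfl
      exact h4 ⟨w, _, hw, hp, rfl⟩
  obtain ⟨ha', hb', -⟩ := general_pair_bounds hG h1 h2
  rw [nextPair_other hG h1 h2]
  have hc : pairColor Δ (mex (upSet G X R v), mex (downSet G X R v)) =
      (mex (upSet G X R v), mex (downSet G X R v)) := if_neg (by simpa using hb'.ne)
  rw [hc]
  simp only [pairColor]
  split_ifs with hb
  · simp only [ne_eq, Prod.mk.injEq, not_and]
    intro h; omega
  · simp only [ne_eq, Prod.mk.injEq, not_and]
    intro h h'
    rcases lt_or_gt_of_ne (hG.proper v w hw) with hx | hx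
    · exact mex_notMem (upSet_finite (G := G) (X := X) (R := R) (v := v))
        (h ▸ (⟨w, b, hw, hx, hp⟩ : a ∈ upSet G X R v))
    · exact mex_notMem (downSet_finite (G := G) (X := X) (R := R) (v := v))
        (h' ▸ (⟨w, a, hw, hx, hp⟩ : b ∈ downSet G X R v))

end Rule

/-! ### Executions of the pair rule -/

/-- An execution in which active nodes propose pairs: `st t v` is the pair of `v` before step `t`,
`reg t v` the one in its register, `fin t v` says that `v` has terminated, and `act t v` that `v` is
activated at step `t`. Thus `reg (t + 1)` is what is read during step `t`. -/
structure PairTrace {V : Type} (G : SimpleGraph V) (X ident : V → ℕ) (Δ : ℕ) where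
  act : ℕ → V → Prop
  st : ℕ → V → Option (ℕ × ℕ)
  reg : ℕ → V → Option (ℕ × ℕ)
  fin : ℕ → V → Prop
  st_zero : ∀ v, st 0 v = none
  reg_zero : ∀ v, reg 0 v = none
  fin_zero : ∀ v, ¬ fin 0 v
  reg_act : ∀ t v, act t v → reg (t + 1) v = st t v
  reg_idle : ∀ t v, ¬ act t v → reg (t + 1) v = reg t v
  idle : ∀ t v, ¬ (act t v ∧ ¬ fin t v) → st (t + 1) v = st t v ∧ (fin (t + 1) v ↔ fin t v)
  halt : ∀ t v p, act t v → ¬ fin t v → st t v = some p →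
    (∀ q ∈ peers G X ident (reg (t + 1)) v, pairColor Δ q.pair ≠ pairColor Δ p) →
    st (t + 1) v = some p ∧ fin (t + 1) v
  move : ∀ t v, act t v → ¬ fin t v →
    (∀ p, st t v = some p →
      ∃ q ∈ peers G X ident (reg (t + 1)) v, pairColor Δ q.pair = pairColor Δ p) →
    st (t + 1) v = some (newPair Δ (X v) (st t v) (peers G X ident (reg (t + 1)) v)) ∧
      ¬ fin (t + 1) v

namespace PairTrace

variable {V : Type} [Fintype V] {G : SimpleGraph V} {X ident : V → ℕ} {Δ : ℕ}
  (T : PairTrace G X ident Δ)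

/-- `v` computes a new pair at step `t`. -/
def Moves (t : ℕ) (v : V) : Prop :=
  T.act t v ∧ ¬ T.fin t v ∧ ∀ p, T.st t v = some p →
    ∃ w q, G.Adj v w ∧ T.reg (t + 1) w = some q ∧ pairColor Δ q = pairColor Δ p

variable {T} {t : ℕ} {u v w : V}

/-! ### Moves, halts and registers -/

theorem Moves.st_succ (h : T.Moves t v) :
    T.st (t + 1) v = some (nextPair G X ident Δ (T.st t v) (T.reg (t + 1)) v) :=
  (T.move t v h.1 h.2.1 fun p hp => exists_mem_peers.mpr (h.2.2 p hp)).1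

theorem Moves.not_fin_succ (h : T.Moves t v) : ¬ T.fin (t + 1) v :=
  (T.move t v h.1 h.2.1 fun p hp => exists_mem_peers.mpr (h.2.2 p hp)).2

theorem halts (ha : T.act t v) (hf : ¬ T.fin t v) (hm : ¬ T.Moves t v) :
    T.st (t + 1) v = T.st t v ∧ T.st t v ≠ none ∧ T.fin (t + 1) v := by
  have : ¬ ∀ p, T.st t v = some p →
    ∃ w q, G.Adj v w ∧ T.reg (t + 1) w = some q ∧ pairColor Δ q = pairColor Δ p :=
    fun h => hm ⟨ha, hf, h⟩
  push Not at this
  obtain ⟨p, hp, h⟩ := this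
  have := T.halt t v p ha hf hp (by
    rintro _ ⟨w, q, hw, hq, rfl⟩
    exact h w q hw hq)
  exact ⟨this.1.trans hp.symm, by simp [hp], this.2⟩

theorem st_succ_of_not_moves (hm : ¬ T.Moves t v) : T.st (t + 1) v = T.st t v := by
  by_cases ha : T.act t v
  · by_cases hf : T.fin t v
    · exact (T.idle t v fun h => h.2 hf).1
    · exact (halts ha hf hm).1
  · exact (T.idle t v fun h => ha h.1).1

theorem fin_succ (hf : T.fin t v) : T.fin (t + 1) v ∧ T.st (t + 1) v = T.st t v :=
  have := T.idle t v fun h => h.2 hf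
  ⟨this.2.mpr hf, this.1⟩

theorem st_succ_ne_none (h : T.st t v ≠ none) : T.st (t + 1) v ≠ none := by
  by_cases hm : T.Moves t v
  · simp [hm.st_succ]
  · rwa [st_succ_of_not_moves hm]

theorem exists_st_of_reg {p : ℕ × ℕ} (h : T.reg t v = some p) : ∃ s < t, T.st s v = some p := by
  induction t with
  | zero => simp [T.reg_zero] at h
  | succ t ih =>
    by_cases ha : T.act t v
    · exact ⟨t, t.lt_succ_self, by rwa [← T.reg_act t v ha]⟩
    · obtain ⟨s, hs, h'⟩ := ih (by rwa [← T.reg_idle t v ha])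
      exact ⟨s, hs.trans t.lt_succ_self, h'⟩

theorem st_valid (hG : Ranked G X ident Δ) {p : ℕ × ℕ} (h : T.st t v = some p) :
    Valid G X Δ v p := by
  induction t generalizing p with
  | zero => simp [T.st_zero] at h
  | succ t ih =>
    by_cases hm : T.Moves t v
    · rw [hm.st_succ] at h
      simp only [Option.some.injEq] at h
      exact h ▸ nextPair_valid hG fun p hp => ih hp
    · exact ih (by rwa [st_succ_of_not_moves hm] at h)

theorem reg_valid (hG : Ranked G X ident Δ) {p : ℕ × ℕ} (h : T.reg t v = some p) :
    Valid G X Δ v p :=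
  let ⟨_, _, h'⟩ := exists_st_of_reg h
  st_valid hG h'

/-- A new pair differs from the previous one. -/
theorem Moves.st_ne (hG : Ranked G X ident Δ) (h : T.Moves t v) :
    T.st (t + 1) v ≠ T.st t v := by
  intro he
  rw [h.st_succ] at he
  obtain ⟨w, q, hw, hq, hc⟩ := h.2.2 _ he.symm
  exact nextPair_avoids hG (fun p hp => st_valid hG hp) (fun w p hp => reg_valid hG hp) hw hq hc

/-- In the step in which it terminates, a node has just written the pair that it keeps; later writes
repeat it. -/
theorem reg_eq_of_fin (hf : T.fin t v) : T.reg t v = T.st t v := by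
  induction t with
  | zero => exact absurd hf (T.fin_zero v)
  | succ t ih =>
    by_cases hf' : T.fin t v
    · rw [(fin_succ hf').2, ← ih hf']
      by_cases ha : T.act t v
      · rw [T.reg_act t v ha, ih hf']
      · exact T.reg_idle t v ha
    · by_cases ha : T.act t v
      · have hm : ¬ T.Moves t v := fun hm => hm.not_fin_succ hf
        rw [T.reg_act t v ha, (halts ha hf' hm).1]
      · exact absurd ((T.idle t v fun h => ha h.1).2.mp hf) hf'

/-- A node that has not terminated has changed its pair since it last wrote it. -/
theorem fin_of_reg_eq (hG : Ranked G X ident Δ) (h : T.reg t v = T.st t v)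
    (hn : T.st t v ≠ none) : T.fin t v := by
  induction t with
  | zero => exact absurd (T.st_zero v) hn
  | succ t ih =>
    by_cases hm : T.Moves t v
    · rw [T.reg_act t v hm.1] at h
      exact absurd h.symm (hm.st_ne hG)
    · rw [st_succ_of_not_moves hm] at h hn
      by_cases hf : T.fin t v
      · exact (fin_succ hf).1
      by_cases ha : T.act t v
      · exact (halts ha hf hm).2.2
      · exact absurd (ih (by rwa [T.reg_idle t v ha] at h) hn) hf

theorem reg_succ_cases (t : ℕ) (v : V) :
    T.reg (t + 1) v = T.reg t v ∨ T.reg (t + 1) v = T.st t v := by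
  by_cases ha : T.act t v
  · exact Or.inr (T.reg_act t v ha)
  · exact Or.inl (T.reg_idle t v ha)

theorem reg_succ_ne_none (h : T.reg t v ≠ none) : T.reg (t + 1) v ≠ none := by
  by_cases ha : T.act t v
  · rw [T.reg_act t v ha]
    obtain ⟨p, hp⟩ := Option.ne_none_iff_exists'.mp h
    obtain ⟨s, hs, h'⟩ := exists_st_of_reg hp
    have : ∀ k, T.st (s + k) v ≠ none := by
      intro k
      induction k with
      | zero => simp [h']
      | succ k ih => exact st_succ_ne_none ih
    have := this (t - s)
    rwa [Nat.add_sub_cancel' hs.le] at this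
  · rwa [T.reg_idle t v ha]

/-- For a function of the pair of `v`, the registers change no more often than the pairs. -/
theorem changes_reg_le {α : Type*} (φ : Option (ℕ × ℕ) → α) (N : ℕ) :
    changes (fun t => φ (T.reg t v)) N ≤ changes (fun t => φ (T.st t v)) N := by
  refine changes_sample (by rw [T.reg_zero, T.st_zero]) (fun t => ?_) N
  rcases reg_succ_cases (T := T) t v with h | h <;> rw [h] <;> simp

/-- Step `t` reads `reg (t + 1)`, and the shifted count up to `N` is compared with the original one
up to `N + 1`; hence the hypothesis for all `N`. -/
theorem changes_reg_succ_le {α : Type*} {φ : Option (ℕ × ℕ) → α} {C : ℕ}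
    (h : ∀ N, changes (fun t => φ (T.st t v)) N ≤ C) (N : ℕ) :
    changes (fun t => φ (T.reg (t + 1) v)) N ≤ C :=
  (changes_shift (fun t => φ (T.reg t v)) N).trans ((changes_reg_le φ _).trans (h _))

open Classical in
/-- The running time is bounded by the number of changes of the pair. -/
theorem active_card_le (hG : Ranked G X ident Δ) (v : V) (N : ℕ) :
    ((Finset.range N).filter fun t => T.act t v ∧ ¬ T.fin t v).card ≤
      changes (fun t => T.st t v) N + 1 := by
  -- Each active step either changes the pair, by `Moves.st_ne`, or terminates the node, which
  -- happens once.
  have : ((Finset.range N).filter fun t => T.act t v ∧ ¬ T.fin t v).card ≤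
      changes (fun t => T.st t v) N + if T.fin N v then 1 else 0 := by
    induction N with
    | zero => simp
    | succ N ih =>
      rw [changes_succ, Finset.range_add_one, Finset.filter_insert]
      by_cases hf : T.fin N v
      · have h2 := (fin_succ hf).1
        simp only [hf, h2, not_true, and_false, if_false, if_true] at ih ⊢
        omega
      · by_cases ha : T.act N v
        · simp only [ha, hf, not_false_eq_true, and_self, if_true, if_false] at ih ⊢
          rw [Finset.card_insert_of_notMem (by simp)]
          by_cases hm : T.Moves N v
          · rw [if_neg (hm.st_ne hG).symm]
            omega
          · have := halts ha hf hm
            rw [if_pos this.2.2]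
            omega
        · simp only [ha, false_and, if_false, hf] at ih ⊢
          omega
  split_ifs at this <;> omega

/-! #### The first component away from local minima -/

theorem Moves.other (hG : Ranked G X ident Δ) (h : T.Moves t v) (h1 : ¬ IsMin G X Δ v)
    (h2 : ¬ IsMax G X Δ v) : T.st (t + 1) v =
      some (mex (upSet G X (T.reg (t + 1)) v), mex (downSet G X (T.reg (t + 1)) v)) := by
  rw [h.st_succ, nextPair_other hG (fun h => h1 h.1) fun h => h2 h.1]

theorem st_zero_of_isMin (hG : Ranked G X ident Δ) (h : IsMin G X Δ v) {p : ℕ × ℕ}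
    (hp : T.st t v = some p) : p.2 = 0 := (st_valid hG hp).snd_of_min h

/-- The first component is a mex determined by the first components read at the at most `Δ` higher
neighbors; the extra change is the initial choice of a pair. -/
theorem changes_fst_other (hG : Ranked G X ident Δ) (h1 : ¬ IsMin G X Δ v) (h2 : ¬ IsMax G X Δ v)
    {C : ℕ} (hC : ∀ w, G.Adj v w → X v < X w →
      ∀ N, changes (fun t => (T.st t w).map Prod.fst) N ≤ C) (N : ℕ) :
    changes (fun t => (T.st t v).map Prod.fst) N ≤ Δ * C + 1 := by
  classical
  refine (changes_update (φ := fun t => some (mex (upSet G X (T.reg (t + 1)) v)))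
    (fun t => ?_) N).trans (Nat.add_le_add_right ?_ 1)
  · by_cases hm : T.Moves t v
    · right; rw [hm.other hG h1 h2]; rfl
    · left; rw [st_succ_of_not_moves hm]
  · refine (changes_le_sum _ ((nb G v).filter fun w => X v < X w)
      (fun w t => (T.reg (t + 1) w).map Prod.fst) (fun t ht => ?_) N).trans ?_
    · by_contra hcon
      push Not at hcon
      refine ht ?_
      congr 2
      ext a
      have key : ∀ w, G.Adj v w → X v < X w →
          ((∃ b, T.reg (t + 1) w = some (a, b)) ↔ ∃ b, T.reg (t + 1 + 1) w = some (a, b)) := by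
        intro w hw hx
        have := hcon w (Finset.mem_filter.mpr ⟨mem_nb.mpr hw, hx⟩)
        have e : ∀ o : Option (ℕ × ℕ), (∃ b, o = some (a, b)) ↔ o.map Prod.fst = some a := by
          intro o; rcases o with _ | ⟨x, y⟩ <;> simp
        rw [e, e, this]
      simp only [upSet, Set.mem_ofPred_eq]
      constructor
      · rintro ⟨w, b, hw, hx, h⟩
        obtain ⟨b', h'⟩ := (key w hw hx).mp ⟨b, h⟩
        exact ⟨w, b', hw, hx, h'⟩
      · rintro ⟨w, b, hw, hx, h⟩
        obtain ⟨b', h'⟩ := (key w hw hx).mpr ⟨b, h⟩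
        exact ⟨w, b', hw, hx, h'⟩
    · refine (Finset.sum_le_card_nsmul _ _ C fun w hw => ?_).trans ?_
      · have hw := Finset.mem_filter.mp hw
        exact changes_reg_succ_le (hC w (mem_nb.mp hw.1) hw.2) N
      · rw [smul_eq_mul]
        exact Nat.mul_le_mul_right _ ((Finset.card_filter_le _ _).trans (hG.card_le v))

theorem changes_snd_other (hG : Ranked G X ident Δ) (h2 : ¬ IsMax G X Δ v)
    {C : ℕ} (hC : ∀ w, G.Adj v w → X w < X v →
      ∀ N, changes (fun t => (T.st t w).map Prod.snd) N ≤ C) (N : ℕ) :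
    changes (fun t => (T.st t v).map Prod.snd) N ≤ Δ * C + 1 := by
  classical
  by_cases h1 : IsMin G X Δ v
  · refine (changes_update (φ := fun _ => some 0) (fun t => ?_) N).trans
      (Nat.add_le_add_right (le_trans (Finset.card_eq_zero.mpr (by simp)).le (Nat.zero_le _)) 1)
    by_cases hm : T.Moves t v
    · right
      have := st_zero_of_isMin hG h1 hm.st_succ
      rw [hm.st_succ]
      simpa using this
    · left; rw [st_succ_of_not_moves hm]
  refine (changes_update (φ := fun t => some (mex (downSet G X (T.reg (t + 1)) v)))
    (fun t => ?_) N).trans (Nat.add_le_add_right ?_ 1)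
  · by_cases hm : T.Moves t v
    · right; rw [hm.other hG h1 h2]; rfl
    · left; rw [st_succ_of_not_moves hm]
  · refine (changes_le_sum _ ((nb G v).filter fun w => X w < X v)
      (fun w t => (T.reg (t + 1) w).map Prod.snd) (fun t ht => ?_) N).trans ?_
    · by_contra hcon
      push Not at hcon
      refine ht ?_
      congr 2
      ext a
      have key : ∀ w, G.Adj v w → X w < X v →
          ((∃ b, T.reg (t + 1) w = some (b, a)) ↔ ∃ b, T.reg (t + 1 + 1) w = some (b, a)) := by
        intro w hw hx
        have := hcon w (Finset.mem_filter.mpr ⟨mem_nb.mpr hw, hx⟩)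
        have e : ∀ o : Option (ℕ × ℕ), (∃ b, o = some (b, a)) ↔ o.map Prod.snd = some a := by
          intro o; rcases o with _ | ⟨x, y⟩ <;> simp
        rw [e, e, this]
      simp only [downSet, Set.mem_ofPred_eq]
      constructor
      · rintro ⟨w, b, hw, hx, h⟩
        obtain ⟨b', h'⟩ := (key w hw hx).mp ⟨b, h⟩
        exact ⟨w, b', hw, hx, h'⟩
      · rintro ⟨w, b, hw, hx, h⟩
        obtain ⟨b', h'⟩ := (key w hw hx).mpr ⟨b, h⟩
        exact ⟨w, b', hw, hx, h'⟩
    · refine (Finset.sum_le_card_nsmul _ _ C fun w hw => ?_).trans ?_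
      · have hw := Finset.mem_filter.mp hw
        exact changes_reg_succ_le (hC w (mem_nb.mp hw.1) hw.2) N
      · rw [smul_eq_mul]
        exact Nat.mul_le_mul_right _ ((Finset.card_filter_le _ _).trans (hG.card_le v))

/-! #### Local extrema that use the common color of `(Δ, 0)` and `(c, Δ)` -/

theorem Moves.min_top (hG : Ranked G X ident Δ) (h : T.Moves t v) {b : ℕ}
    (hs : T.st (t + 1) v = some (Δ, b)) :
    IsMin G X Δ v ∧ Full G (T.reg (t + 1)) v ∧ mex (minSet G (T.reg (t + 1)) v) = Δ := by
  have h1 : IsMin G X Δ v := by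
    by_contra hn
    exact absurd ((st_valid hG hs).fst_of_not_min hn) (lt_irrefl _)
  rw [h.st_succ] at hs
  have h2 : Full G (T.reg (t + 1)) v := by
    by_contra hn
    rw [nextPair_other hG (fun h => hn h.2) fun h => hn h.2] at hs
    have := (general_pair_bounds hG (fun h => hn h.2) fun h => hn h.2 :
      mex (upSet G X (T.reg (t + 1)) v) < Δ ∧ _).1
    simp only [Option.some.injEq, Prod.mk.injEq] at hs
    omega
  rw [nextPair_min hG h1 h2] at hs
  simp only [Option.some.injEq, Prod.mk.injEq] at hs
  exact ⟨h1, h2, hs.1⟩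

theorem Moves.max_top (hG : Ranked G X ident Δ) (h : T.Moves t v) {c : ℕ}
    (hs : T.st (t + 1) v = some (c, Δ)) :
    IsMax G X Δ v ∧ Full G (T.reg (t + 1)) v ∧ Δ ≤ mex (maxSet G (T.reg (t + 1)) v c) ∧
      ∀ w p, G.Adj v w → T.reg (t + 1) w = some p → p.1 ≠ Δ := by
  have h1 : IsMax G X Δ v := by
    by_contra hn
    exact absurd ((st_valid hG hs).snd_of_not_max hn) (lt_irrefl _)
  rw [h.st_succ] at hs
  have h2 : Full G (T.reg (t + 1)) v := by
    by_contra hn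
    rw [nextPair_other hG (fun h => hn h.2) fun h => hn h.2] at hs
    have := (general_pair_bounds hG (fun h => hn h.2) fun h => hn h.2 :
      mex (upSet G X (T.reg (t + 1)) v) < Δ ∧ _).2.1
    simp only [Option.some.injEq, Prod.mk.injEq] at hs
    omega
  rw [nextPair_max hG h1 h2] at hs
  have := hG.two_le
  split_ifs at hs with h3 h4 <;> simp only [Option.some.injEq, Prod.mk.injEq] at hs
  · omega
  · omega
  · refine ⟨h1, h2, hs.1 ▸ not_lt.mp h3, fun w p hw hp hpΔ => h4 ⟨w, p, hw, hp, hpΔ⟩⟩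

theorem exists_moves_of_st {p : ℕ × ℕ} (h : T.st t v = some p) :
    ∃ s < t, T.Moves s v ∧ T.st (s + 1) v = some p := by
  induction t with
  | zero => simp [T.st_zero] at h
  | succ t ih =>
    by_cases hm : T.Moves t v
    · exact ⟨t, t.lt_succ_self, hm, h⟩
    · obtain ⟨s, hs, h'⟩ := ih (by rwa [st_succ_of_not_moves hm] at h)
      exact ⟨s, hs.trans t.lt_succ_self, h'⟩

theorem full_mono {s : ℕ} (hst : s ≤ t) (h : Full G (T.reg s) v) : Full G (T.reg t) v := by
  induction hst with
  | refl => exact h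
  | step _ ih => exact fun w hw => reg_succ_ne_none (ih w hw)

theorem isMax_of_top (hG : Ranked G X ident Δ) {c : ℕ} (h : T.st t u = some (c, Δ)) :
    IsMax G X Δ u := by
  by_contra hn
  exact absurd ((st_valid hG h).snd_of_not_max hn) (lt_irrefl _)

theorem full_of_top (hG : Ranked G X ident Δ) {c : ℕ} (h : T.st t u = some (c, Δ)) :
    Full G (T.reg t) u := by
  obtain ⟨s, hs, hm, h'⟩ := exists_moves_of_st h
  exact full_mono hs (hm.max_top hG h').2.1

/-- A local maximum that uses `(c, Δ)` has at most one neighbor that is a local minimum. -/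
theorem isMin_unique (hG : Ranked G X ident Δ) {c : ℕ} (h : T.st t u = some (c, Δ))
    (hv : G.Adj u v) (hw : G.Adj u w) (hv' : IsMin G X Δ v) (hw' : IsMin G X Δ w) : v = w := by
  obtain ⟨s, hs, hm, h'⟩ := exists_moves_of_st h
  exact unique_of_full_level hG (hm.max_top hG h').2.2.1 hv hw
    (fun b hb => (reg_valid hG hb).snd_of_min hv') (fun b hb => (reg_valid hG hb).snd_of_min hw')

theorem isMin_of_reg (hG : Ranked G X ident Δ) {b : ℕ} (h : T.reg t v = some (Δ, b)) :
    IsMin G X Δ v := by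
  by_contra hn
  exact absurd ((reg_valid hG h).fst_of_not_min hn) (lt_irrefl _)

/-- A node moves away from `(c, Δ)` only because of a neighbor that uses `(Δ, 0)`; it then changes
its first component. -/
theorem Moves.toggle (hG : Ranked G X ident Δ) (h : T.Moves t u) {c : ℕ}
    (hs : T.st t u = some (c, Δ)) :
    (∃ v, G.Adj u v ∧ IsMin G X Δ v ∧ T.reg (t + 1) v = some (Δ, 0)) ∧
      ∃ b, b ≠ Δ ∧ T.st (t + 1) u = some (1 - c, b) := by
  have hmax := isMax_of_top hG hs
  have h1 : ∃ v, G.Adj u v ∧ IsMin G X Δ v ∧ T.reg (t + 1) v = some (Δ, 0) := by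
    obtain ⟨v, q, hv, hq, hc⟩ := h.2.2 _ hs
    have hb := (reg_valid hG hq).snd_of_not_max (hmax.not_isMax_adj hv)
    rw [pairColor, pairColor, if_neg hb.ne, if_pos rfl] at hc
    subst hc
    exact ⟨v, hv, isMin_of_reg hG hq, hq⟩
  refine ⟨h1, ?_⟩
  have hf : Full G (T.reg (t + 1)) u := full_mono t.le_succ (full_of_top hG hs)
  have hst := h.st_succ
  rw [nextPair_max hG hmax hf, hs] at hst
  have hl : level Δ (some (c, Δ)) = 1 - c := by simp [level]
  rw [hl] at hst
  have := hG.two_le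
  split_ifs at hst with h3 h4
  · exact ⟨_, h3.ne, hst⟩
  · exact ⟨0, by omega, hst⟩
  · obtain ⟨v, hv, -, hq⟩ := h1
    exact absurd ⟨v, _, hv, hq, rfl⟩ h4

theorem fst_eq_zero_of_not_full (hG : Ranked G X ident Δ) (hu : IsMax G X Δ u)
    (hf : ¬ Full G (T.reg t) u) {p : ℕ × ℕ} (hp : T.st t u = some p) : p.1 = 0 := by
  obtain ⟨s, hs, hm, h'⟩ := exists_moves_of_st hp
  have hf' : ¬ Full G (T.reg (s + 1)) u := fun h => hf (full_mono hs h)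
  rw [hm.st_succ, nextPair_other hG (fun h => hf' h.2) (fun h => hf' h.2), upSet_eq_empty hu,
    mex_empty] at h'
  simp only [Option.some.injEq] at h'
  rw [← h']

/-- With a full view, `level` keeps `c` because `b ≠ Δ`. Without it, the general rule gives first
component `0`; as full views are permanent, it was the general rule that gave `c` too, so `c = 0`.
-/
theorem Moves.fst_of_ne_top (hG : Ranked G X ident Δ) (h : T.Moves t u) (hu : IsMax G X Δ u)
    {c b : ℕ} (hs : T.st t u = some (c, b)) (hb : b ≠ Δ) :
    ∃ b', T.st (t + 1) u = some (c, b') := by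
  have hl : level Δ (T.st t u) = c := by simp [level, hs, hb]
  have hst := h.st_succ
  by_cases hf : Full G (T.reg (t + 1)) u
  · rw [nextPair_max hG hu hf, hl] at hst
    split_ifs at hst <;> exact ⟨_, hst⟩
  · have h0 := fst_eq_zero_of_not_full hG hu (fun h => hf (full_mono t.le_succ h)) hs
    rw [nextPair_other hG (fun h => hf h.2) (fun h => hf h.2), upSet_eq_empty hu,
      mex_empty] at hst
    simp only at h0
    exact ⟨_, h0 ▸ hst⟩

theorem Moves.fst_of_none (hG : Ranked G X ident Δ) (h : T.Moves t u) (hu : IsMax G X Δ u)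
    (hs : T.st t u = none) : ∃ b', T.st (t + 1) u = some (0, b') := by
  have hst := h.st_succ
  by_cases hf : Full G (T.reg (t + 1)) u
  · rw [nextPair_max hG hu hf, hs] at hst
    rw [show level Δ none = 0 from rfl] at hst
    split_ifs at hst <;> exact ⟨_, hst⟩
  · rw [nextPair_other hG (fun h => hf h.2) (fun h => hf h.2), upSet_eq_empty hu,
      mex_empty] at hst
    exact ⟨_, hst⟩

/-- The first component of a local maximum changes only when it moves away from `(c, Δ)`. -/
theorem toggle_of_fst_ne (hG : Ranked G X ident Δ) (hu : IsMax G X Δ u)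
    (hn : T.st t u ≠ none) (h : (T.st t u).map Prod.fst ≠ (T.st (t + 1) u).map Prod.fst) :
    T.Moves t u ∧ ∃ c, T.st t u = some (c, Δ) := by
  have hm : T.Moves t u := by
    by_contra hm
    exact h (by rw [st_succ_of_not_moves hm])
  refine ⟨hm, ?_⟩
  obtain ⟨⟨c, b⟩, hp⟩ := Option.ne_none_iff_exists'.mp hn
  by_cases hb : b = Δ
  · exact ⟨c, hb ▸ hp⟩
  · obtain ⟨b', hb'⟩ := hm.fst_of_ne_top hG hu hp hb
    exact absurd (by rw [hp, hb']; rfl) h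

/-- Since its last write a node has moved at most once, in the very step of that write, and a move
from a pair other than `(c, Δ)` keeps the first component. -/
theorem fst_of_reg (hG : Ranked G X ident Δ) (hu : IsMax G X Δ u) {c b : ℕ}
    (h : T.reg (t + 1) u = some (c, b)) (hb : b ≠ Δ) :
    (T.st (t + 1) u).map Prod.fst = some c := by
  induction t with
  | zero =>
    by_cases ha : T.act 0 u
    · rw [T.reg_act _ _ ha, T.st_zero] at h; cases h
    · rw [T.reg_idle _ _ ha, T.reg_zero] at h; cases h
  | succ t ih =>
    by_cases ha : T.act (t + 1) u
    · rw [T.reg_act _ _ ha] at h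
      by_cases hm : T.Moves (t + 1) u
      · obtain ⟨b', hb'⟩ := hm.fst_of_ne_top hG hu h hb
        simp [hb']
      · simp [st_succ_of_not_moves hm, h]
    · rw [st_succ_of_not_moves fun hm => ha hm.1]
      exact ih (by rwa [T.reg_idle _ _ ha] at h)

/-! #### The first component of a local maximum -/

/-- The first components of the neighbors of `v` other than `u` whose second component is `0`. -/
def otherSet (T : PairTrace G X ident Δ) (u v : V) (t : ℕ) : Set ℕ :=
  {a | ∃ w, G.Adj v w ∧ w ≠ u ∧ T.reg (t + 1) w = some (a, 0)}

/-- When `v` chooses `(Δ, 0)`, its neighbors show all `(a, 0)` with `a < Δ`, once each, so `u` shows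
the one that the others miss. The level of `u` at such a time is thus determined by the other
neighbors. -/
theorem Moves.reg_of_min_top (hG : Ranked G X ident Δ) (h : T.Moves t v) (hu : G.Adj v u)
    (hs : T.st (t + 1) v = some (Δ, 0)) :
    T.reg (t + 1) u = some (mex (T.otherSet u v t), 0) := by
  obtain ⟨-, -, hm⟩ := h.min_top hG hs
  obtain ⟨h1, h2⟩ := forall_of_mex_minSet hG hm
  obtain ⟨c, hc, hc'⟩ := h1 u hu
  rw [hc', mex_eq (x := c)]
  · rintro ⟨w, hw, hwu, hw'⟩
    exact hwu (h2 w u c hw hu hw' hc')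
  · intro y hy
    obtain ⟨w, hw, hw'⟩ : y ∈ minSet G (T.reg (t + 1)) v := mem_of_lt_mex (by omega)
    refine ⟨w, hw, ?_, hw'⟩
    rintro rfl
    rw [hc'] at hw'
    simp only [Option.some.injEq, Prod.mk.injEq] at hw'
    omega

open Classical in
/-- The first component that `v` saw at `u` when it last chose `(Δ, 0)`. -/
def seenLevel (T : PairTrace G X ident Δ) (u v : V) : ℕ → ℕ
  | 0 => 0
  | t + 1 => if T.Moves t v ∧ T.st (t + 1) v = some (Δ, 0) then mex (T.otherSet u v t)
      else seenLevel T u v t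

/-- A cycle of three phases. While `u` has the level that `v` last saw, it may switch, but only if
`v` shows `(Δ, 0)`; this leads to the second phase. There `u` cannot choose `(c, Δ)` as long as `v`
shows `(Δ, 0)`. When `v` shows something else the third phase starts, and it lasts at least until
`v` chooses `(Δ, 0)` anew, which restores the agreement. So `u` can switch level only in the first
phase. -/
theorem seenLevel_inv (hG : Ranked G X ident Δ) (hu : IsMax G X Δ u) (huv : G.Adj u v)
    (huniq : ∀ w, G.Adj u w → IsMin G X Δ w → w = v) (t : ℕ) :
    (T.st t u).map Prod.fst = some (T.seenLevel u v t) ∨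
    (T.reg t v = some (Δ, 0) ∧ ∀ c, T.st t u ≠ some (c, Δ)) ∨
    (T.reg t v ≠ some (Δ, 0) ∧ T.st t v ≠ some (Δ, 0)) := by
  have hΔ := hG.two_le
  induction t with
  | zero => right; right; simp [T.st_zero, T.reg_zero]
  | succ t ih =>
    by_cases hc : T.Moves t v ∧ T.st (t + 1) v = some (Δ, 0)
    · left
      rw [seenLevel, if_pos hc]
      exact fst_of_reg hG hu (hc.1.reg_of_min_top hG huv.symm hc.2) (by omega)
    rw [seenLevel, if_neg hc]
    have hst : T.st t v ≠ some (Δ, 0) → T.st (t + 1) v ≠ some (Δ, 0) := by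
      intro h h'
      by_cases hm : T.Moves t v
      · exact hc ⟨hm, h'⟩
      · exact h (by rwa [st_succ_of_not_moves hm] at h')
    rcases ih with ih | ⟨ih1, ih2⟩ | ⟨ih1, ih2⟩
    · by_cases hch : (T.st t u).map Prod.fst = (T.st (t + 1) u).map Prod.fst
      · left; rw [← hch, ih]
      · right; left
        obtain ⟨hm, c, hs⟩ := toggle_of_fst_ne hG hu (by rintro h; simp [h] at ih) hch
        obtain ⟨⟨w, hw, hw', hr⟩, b, hb, hst'⟩ := hm.toggle hG hs
        rw [huniq w hw hw'] at hr
        refine ⟨hr, fun c' h => hb ?_⟩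
        rw [hst'] at h
        simp only [Option.some.injEq, Prod.mk.injEq] at h
        exact h.2
    · by_cases hr : T.reg (t + 1) v = some (Δ, 0)
      · right; left
        refine ⟨hr, fun c h => ?_⟩
        by_cases hm : T.Moves t u
        · exact (hm.max_top hG h).2.2.2 v _ huv hr rfl
        · exact ih2 c (by rwa [st_succ_of_not_moves hm] at h)
      · right; right
        refine ⟨hr, ?_⟩
        have ha : T.act t v := by
          by_contra ha
          exact hr (by rw [T.reg_idle t v ha, ih1])
        exact hst (by rwa [T.reg_act t v ha] at hr)
    · right; right
      refine ⟨?_, hst ih2⟩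
      rcases reg_succ_cases (T := T) t v with h | h <;> rwa [h]

theorem fst_eq_seenLevel (hG : Ranked G X ident Δ) (hu : IsMax G X Δ u) (huv : G.Adj u v)
    (huniq : ∀ w, G.Adj u w → IsMin G X Δ w → w = v) (hn : T.st t u ≠ none)
    (h : (T.st t u).map Prod.fst ≠ (T.st (t + 1) u).map Prod.fst) :
    (T.st t u).map Prod.fst = some (T.seenLevel u v t) := by
  obtain ⟨hm, c, hs⟩ := toggle_of_fst_ne hG hu hn h
  obtain ⟨⟨w, hw, hw', hr⟩, -⟩ := hm.toggle hG hs
  rw [huniq w hw hw'] at hr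
  rcases seenLevel_inv hG hu huv huniq t with h1 | ⟨-, h1⟩ | ⟨h1, h2⟩
  · exact h1
  · exact absurd hs (h1 c)
  · rcases reg_succ_cases (T := T) t v with h | h
    · exact absurd (h ▸ hr) h1
    · exact absurd (h ▸ hr) h2

/-- As long as its only local minimum does not use `(Δ, 0)`, the first component of a local maximum
is `0`. -/
theorem fst_eq_zero_of_forall (hG : Ranked G X ident Δ) (hw : IsMax G X Δ w) (hwv : G.Adj w v)
    (hv : IsMin G X Δ v) (h : ∀ s ≤ t, T.reg s v ≠ some (Δ, 0)) {p : ℕ × ℕ}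
    (hp : T.st t w = some p) : p.1 = 0 := by
  induction t generalizing p with
  | zero => simp [T.st_zero] at hp
  | succ t ih =>
    by_cases hm : T.Moves t w
    · rcases hs : T.st t w with _ | ⟨c, b⟩
      · obtain ⟨b', hb'⟩ := hm.fst_of_none hG hw hs
        rw [hb'] at hp
        simp only [Option.some.injEq] at hp
        rw [← hp]
      · by_cases hb : b = Δ
        · subst hb
          obtain ⟨⟨z, hz, hz', hr⟩, -⟩ := hm.toggle hG hs
          rw [isMin_unique hG hs hz hwv hz' hv] at hr
          exact absurd hr (h _ le_rfl)
        · obtain ⟨b', hb'⟩ := hm.fst_of_ne_top hG hw hs hb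
          have := ih (fun s hs => h s (hs.trans t.le_succ)) hs
          rw [hb'] at hp
          simp only [Option.some.injEq] at hp
          rw [← hp, ← this]
    · exact ih (fun s hs => h s (hs.trans t.le_succ)) (by rwa [st_succ_of_not_moves hm] at hp)

/-- A local minimum that uses `(Δ, 0)` has at most one neighbor that is a local maximum. -/
theorem isMax_unique (hG : Ranked G X ident Δ) (h : T.st t v = some (Δ, 0))
    (hu : IsMax G X Δ u) (hw : IsMax G X Δ w) (hvu : G.Adj v u) (hvw : G.Adj v w) : u = w := by
  classical
  -- At the first choice of `(Δ, 0)` by `v`, no neighboring maximum has been driven to level `1`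
  -- yet. All of them therefore show `(0, 0)`, which only one neighbor may show.
  have hex : ∃ t, T.st t v = some (Δ, 0) := ⟨t, h⟩
  obtain ⟨s, hs, hm, hst⟩ := exists_moves_of_st (Nat.find_spec hex)
  obtain ⟨hv, -, hmex⟩ := hm.min_top hG hst
  obtain ⟨h1, h2⟩ := forall_of_mex_minSet hG hmex
  have hreg : ∀ r ≤ s, T.reg r v ≠ some (Δ, 0) := by
    intro r hr h'
    obtain ⟨r', hr', h''⟩ := exists_st_of_reg h'
    exact Nat.find_min hex (by omega) h''
  have hz : ∀ z, IsMax G X Δ z → G.Adj v z → T.reg (s + 1) z = some (0, 0) := by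
    intro z hz hvz
    obtain ⟨a, ha, ha'⟩ := h1 z hvz
    obtain ⟨r, hr, hr'⟩ := exists_st_of_reg ha'
    have := fst_eq_zero_of_forall hG hz hvz.symm hv (fun r' h => hreg r' (by omega)) hr'
    simp only at this
    rw [ha', this]
  exact h2 u w 0 hvu hvw (hz u hu hvu) (hz w hw hvw)

/-- Once `v` is visible, the new pairs of its higher neighbors have a positive second component. -/
theorem Moves.snd_pos (hG : Ranked G X ident Δ) (hv : IsMin G X Δ v) (hvw : G.Adj v w)
    (hw : ¬ IsMax G X Δ w) (hr : T.reg (t + 1) v ≠ none) (hm : T.Moves t w) {p : ℕ × ℕ}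
    (hp : T.st (t + 1) w = some p) : p.2 ≠ 0 := by
  rw [hm.other hG (hv.not_isMin_adj hvw) hw] at hp
  simp only [Option.some.injEq] at hp
  rw [← hp]
  obtain ⟨q, hq⟩ := Option.ne_none_iff_exists'.mp hr
  have h0 : 0 ∈ downSet G X (T.reg (t + 1)) w :=
    ⟨v, q.1, hvw.symm, hv.2 w hvw, by rw [hq, ← (reg_valid hG hq).snd_of_min hv]⟩
  exact (mex_pos downSet_finite h0).ne'

/-- The pair in a register, if its second component is `0`. -/
def zeroPart (o : Option (ℕ × ℕ)) : Option (ℕ × ℕ) := o.filter fun p => p.2 = 0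

theorem zeroPart_eq_none_of {p : ℕ × ℕ} (h : p.2 ≠ 0) : zeroPart (some p) = none := by
  simp [zeroPart, h]

open Classical in
-- Once `v` is visible, `w` computes no further pair with second component `0`. Only the pair in its
-- register and the one in its state, both chosen before, can still contribute.
theorem changes_zeroPart (hG : Ranked G X ident Δ) (hv : IsMin G X Δ v) (hvw : G.Adj v w)
    (hw : ¬ IsMax G X Δ w) (N : ℕ) :
    changes (fun t => if T.reg (t + 1) v = none then none else zeroPart (T.reg (t + 1) w)) N
      ≤ 4 := by
  have : changes (fun t => if T.reg (t + 1) v = none then none else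
        zeroPart (T.reg (t + 1) w)) N +
      -- The potential bounds the changes to come: `2` for a zero pair in the state, still to be
      -- shown and then erased, and `1` for a zero pair in the register, still to be erased. The
      -- start value `4` adds one for the step in which `v` becomes visible.
      (if T.reg (N + 1) v = none then 4 else if T.fin (N + 1) w then 0 else
        (if zeroPart (T.st (N + 1) w) = none then 0 else 2) +
        (if zeroPart (T.reg (N + 1) w) = none then 0 else 1)) ≤ 4 := by
    induction N with
    | zero => split_ifs <;> simp
    | succ N ih =>
      rw [changes_succ]
      by_cases h2 : T.reg (N + 1 + 1) v = none
      · have h1 : T.reg (N + 1) v = none := by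
          by_contra h
          exact reg_succ_ne_none h h2
        simpa [h1, h2] using ih
      by_cases h1 : T.reg (N + 1) v = none
      · simp only [h1, h2, if_true, if_false] at ih ⊢
        split_ifs <;> omega
      simp only [h1, h2, if_false] at ih ⊢
      by_cases hf : T.fin (N + 1) w
      · have h3 := fin_succ hf
        have h4 : T.reg (N + 1 + 1) w = T.reg (N + 1) w := by
          rw [reg_eq_of_fin h3.1, reg_eq_of_fin hf, h3.2]
        simp only [hf, h3.1, h4, if_true] at ih ⊢
        exact ih
      by_cases ha : T.act (N + 1) w
      · rw [T.reg_act _ _ ha]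
        by_cases hm : T.Moves (N + 1) w
        · obtain ⟨p, hp⟩ := Option.ne_none_iff_exists'.mp
            (show T.st (N + 1 + 1) w ≠ none by simp [hm.st_succ])
          have hz : zeroPart (T.st (N + 1 + 1) w) = none := by
            rw [hp]; exact zeroPart_eq_none_of (hm.snd_pos hG hv hvw hw h2 hp)
          simp only [hf, hz, hm.not_fin_succ, if_true, if_false] at ih ⊢
          by_cases e1 : zeroPart (T.st (N + 1) w) = none <;>
            by_cases e2 : zeroPart (T.reg (N + 1) w) = none
          · simp only [e1, e2, if_true] at ih ⊢; omega
          · simp only [e1, e2, if_true, if_false] at ih ⊢; omega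
          · simp only [e1, e2, if_true, if_false] at ih ⊢; split_ifs <;> omega
          · simp only [e1, e2, if_false] at ih ⊢; split_ifs <;> omega
        · obtain ⟨h3, -, h4⟩ := halts ha hf hm
          simp only [hf, h4, if_true, if_false] at ih ⊢
          by_cases e1 : zeroPart (T.st (N + 1) w) = none <;>
            by_cases e2 : zeroPart (T.reg (N + 1) w) = none
          · simp only [e1, e2, if_true] at ih ⊢; omega
          · simp only [e1, e2, if_true, if_false] at ih ⊢; omega
          · simp only [e1, e2, if_true, if_false] at ih ⊢; split_ifs <;> omega
          · simp only [e1, e2, if_false] at ih ⊢; split_ifs <;> omega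
      · have h3 := T.idle (N + 1) w fun h => ha h.1
        rw [T.reg_idle _ _ ha, h3.1]
        simp only [hf, h3.2, if_true, if_false] at ih ⊢
        exact ih
  exact le_of_add_le_left this

theorem otherSet_eq {s : ℕ} (h : ∀ w, G.Adj v w → w ≠ u →
    zeroPart (T.reg (t + 1) w) = zeroPart (T.reg (s + 1) w)) :
    T.otherSet u v t = T.otherSet u v s := by
  have e : ∀ (o : Option (ℕ × ℕ)) (a : ℕ), o = some (a, 0) ↔ zeroPart o = some (a, 0) := by
    intro o a
    rcases o with _ | ⟨x, y⟩
    · simp [zeroPart]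
    · by_cases hy : y = 0 <;> simp [zeroPart, Option.filter, hy]
  ext a
  simp only [otherSet, Set.mem_ofPred_eq]
  refine exists_congr fun w => and_congr_right fun hw => and_congr_right fun hwu => ?_
  rw [e (T.reg (t + 1) w), h w hw hwu, ← e]

/-- If `v` ever uses `(Δ, 0)`, no neighbor other than `u` is a maximum, so `changes_zeroPart`
applies to all of them and `otherSet` varies little. Besides `4 * Δ`, one change comes from `v`
becoming visible and one from the initial value of `seenLevel`. -/
theorem changes_seenLevel (hG : Ranked G X ident Δ) (hu : IsMax G X Δ u) (hv : IsMin G X Δ v)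
    (hvu : G.Adj v u) (N : ℕ) : changes (T.seenLevel u v) N ≤ 4 * Δ + 2 := by
  classical
  by_cases hex : ∃ t, T.st t v = some (Δ, 0)
  swap
  · push Not at hex
    have : ∀ t, T.seenLevel u v t = 0 := by
      intro t
      induction t with
      | zero => rfl
      | succ t ih => rw [seenLevel, if_neg fun h => hex _ h.2, ih]
    have h0 : changes (T.seenLevel u v) N = 0 := by simp [changes, this]
    omega
  obtain ⟨t₀, ht₀⟩ := hex
  have hmax : ∀ w, G.Adj v w → w ≠ u → ¬ IsMax G X Δ w := fun w hw hne hw' =>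
    hne (isMax_unique hG ht₀ hw' hu hw hvu)
  -- While the register of `v` is empty nothing restrains its neighbors, but `v` can make only one
  -- move with an empty register, its first; `γ` is the value sampled there.
  obtain ⟨γ, hγ⟩ : ∃ γ, ∀ t, T.Moves t v → T.st t v = none → mex (T.otherSet u v t) = γ := by
    by_cases h : ∃ t, T.Moves t v ∧ T.st t v = none
    · obtain ⟨t, hm, hn⟩ := h
      refine ⟨mex (T.otherSet u v t), fun s hsm hsn => ?_⟩
      have key : ∀ a b, T.Moves a v → T.st b v = none → b ≤ a := by
        intro a b ha hb
        by_contra hlt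
        have : ∀ k, T.st (a + 1 + k) v ≠ none := by
          intro k
          induction k with
          | zero => simp [ha.st_succ]
          | succ k ih => exact st_succ_ne_none ih
        have := this (b - (a + 1))
        rw [Nat.add_sub_cancel' (by omega)] at this
        exact this hb
      rw [le_antisymm (key t s hm hsn) (key s t hsm hn)]
    · exact ⟨0, fun t hm hn => absurd ⟨t, hm, hn⟩ h⟩
  set φ : ℕ → ℕ := fun t => if T.reg (t + 1) v = none then γ else mex (T.otherSet u v t) with hφ
  have h1 : changes (T.seenLevel u v) N ≤ changes φ N + 1 := by
    refine changes_update (fun t => ?_) N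
    by_cases hc : T.Moves t v ∧ T.st (t + 1) v = some (Δ, 0)
    · right
      rw [seenLevel, if_pos hc, hφ]
      by_cases hr : T.reg (t + 1) v = none
      · simp only [hr, if_true]
        exact hγ t hc.1 (by rwa [T.reg_act _ _ hc.1.1] at hr)
      · simp only [hr, if_false]
    · left; rw [seenLevel, if_neg hc]
  have h2 : changes φ N ≤ changes (fun t => T.reg (t + 1) v ≠ none) N +
      changes (fun t => fun w : ((nb G v).erase u : Finset V) =>
        if T.reg (t + 1) v = none then none else zeroPart (T.reg (t + 1) w)) N := by
    refine changes_le_add _ _ _ (fun t ht => ?_) N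
    by_contra hcon
    push Not at hcon
    obtain ⟨c1, c2⟩ := hcon
    refine ht ?_
    simp only [hφ]
    by_cases hr : T.reg (t + 1) v = none
    · have hr' : T.reg (t + 1 + 1) v = none := by
        by_contra h
        exact absurd c1 (by simp [hr, h])
      simp only [hr, hr', if_true]
    · have hr' : T.reg (t + 1 + 1) v ≠ none := reg_succ_ne_none hr
      simp only [hr, hr', if_false]
      congr 1
      refine otherSet_eq fun w hw hne => ?_
      have := congrFun c2 ⟨w, Finset.mem_erase.mpr ⟨hne, mem_nb.mpr hw⟩⟩
      simpa only [hr, hr', if_false] using this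
  have h3 : changes (fun t => T.reg (t + 1) v ≠ none) N ≤ 1 :=
    changes_le_one_of_monotone (fun t h => reg_succ_ne_none h) N
  have h4 : changes (fun t => fun w : ((nb G v).erase u : Finset V) =>
      if T.reg (t + 1) v = none then none else zeroPart (T.reg (t + 1) w)) N ≤ Δ * 4 := by
    refine (changes_le_sum _ Finset.univ (fun (w : ((nb G v).erase u : Finset V)) t =>
      if T.reg (t + 1) v = none then none else zeroPart (T.reg (t + 1) w)) (fun t ht => ?_)
      N).trans ?_
    · by_contra hcon
      push Not at hcon
      exact ht (funext fun w => hcon w (Finset.mem_univ _))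
    · refine (Finset.sum_le_card_nsmul _ _ 4 fun w _ => ?_).trans ?_
      · have hw := Finset.mem_erase.mp w.2
        exact changes_zeroPart hG hv (mem_nb.mp hw.2) (hmax w (mem_nb.mp hw.2) hw.1) N
      · rw [smul_eq_mul, Finset.card_univ, Fintype.card_coe]
        exact Nat.mul_le_mul_right _ (((Finset.card_erase_le).trans (hG.card_le v)))
  omega

/-- A change of level is possible only from the value `seenLevel`, so `changes_le_of_leave` adds `2`
to the bound `4 * Δ + 2`. If `u` never leaves any `(c, Δ)`, its level never changes after the first
choice. -/
theorem changes_fst_max (hG : Ranked G X ident Δ) (hu : IsMax G X Δ u) (N : ℕ) :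
    changes (fun t => (T.st t u).map Prod.fst) N ≤ 4 * Δ + 4 := by
  have hn : ∀ t, (T.st t u).map Prod.fst ≠ none → (T.st (t + 1) u).map Prod.fst ≠ none := by
    intro t h
    simp only [ne_eq, Option.map_eq_none_iff] at h ⊢
    exact st_succ_ne_none h
  by_cases hex : ∃ t c, T.Moves t u ∧ T.st t u = some (c, Δ)
  · obtain ⟨t, c, hm, hs⟩ := hex
    obtain ⟨⟨v, huv, hv, hr⟩, -⟩ := hm.toggle hG hs
    have huniq : ∀ w, G.Adj u w → IsMin G X Δ w → w = v := fun w hw hw' =>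
      isMin_unique hG hs hw huv hw' hv
    have h1 := changes_le_of_leave (l := T.seenLevel u v) hn (fun t ht => by
      by_cases h0 : T.st t u = none
      · left; simp [h0]
      · right; exact fst_eq_seenLevel hG hu huv huniq h0 ht) N
    have h2 := changes_seenLevel (T := T) hG hu hv huv.symm N
    omega
  · have h1 := changes_le_of_leave (l := fun _ => 0) hn (fun t ht => by
      left
      by_contra h0
      simp only [Option.map_eq_none_iff] at h0
      obtain ⟨hm, c, hs⟩ := toggle_of_fst_ne hG hu h0 ht
      exact hex ⟨t, c, hm, hs⟩) N
    have h2 : changes (fun _ : ℕ => 0) N = 0 := by simp [changes]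
    omega

/-! #### Bounds on the number of moves -/

/-- Leaving `(c, Δ)` replaces the first component `c ∈ {0, 1}` by `1 - c`, so departures are counted
by the changes of the first component. -/
theorem changes_top_max (hG : Ranked G X ident Δ) (hu : IsMax G X Δ u) (N : ℕ) :
    changes (fun t => ∃ c, T.st t u = some (c, Δ)) N ≤ 8 * Δ + 9 := by
  classical
  refine (changes_le_of_off (C := 4 * Δ + 4) fun S hS => ?_).trans (by omega)
  refine (card_le_changes fun t ht => ?_).trans (changes_fst_max (T := T) hG hu N)
  obtain ⟨h0, ⟨c, hc⟩, hoff⟩ := hS t ht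
  refine ⟨h0, fun he => ?_⟩
  by_cases hm : T.Moves t u
  · obtain ⟨-, b, -, hb⟩ := hm.toggle hG hc
    rw [hc, hb] at he
    simp only [Option.map_some, Option.some.injEq] at he
    have := (st_valid hG hc).fst_of_max hu
    simp only at this
    omega
  · exact hoff ⟨c, by rw [st_succ_of_not_moves hm, hc]⟩

/-- If a local minimum is about to use `(Δ, 0)`, then a neighbor that already uses that color has
terminated. -/
theorem fin_of_reg_top (hG : Ranked G X ident Δ) (hvu : G.Adj v u) (h1 : T.st t v = some (Δ, 0))
    (h2 : T.reg t v ≠ some (Δ, 0)) {c : ℕ} (h3 : T.reg t u = some (c, Δ)) : T.fin t u := by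
  have hΔ := hG.two_le
  induction t with
  | zero => simp [T.st_zero] at h1
  | succ t ih =>
    by_cases hm : T.Moves t v
    · have := hm.reg_of_min_top hG hvu h1
      rw [h3] at this
      simp only [Option.some.injEq, Prod.mk.injEq] at this
      omega
    rw [st_succ_of_not_moves hm] at h1
    have ha : ¬ T.act t v := fun ha => h2 (by rw [T.reg_act _ _ ha, h1])
    have h2' : T.reg t v ≠ some (Δ, 0) := by rwa [T.reg_idle _ _ ha] at h2
    by_cases hf : T.fin t u
    · exact (fin_succ hf).1
    by_cases hau : T.act t u
    · rw [T.reg_act _ _ hau] at h3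
      by_cases hmu : T.Moves t u
      -- To move away from `(c, Δ)`, `u` must read `(Δ, 0)` at its only neighboring minimum, `v`,
      -- which has not written that pair. So `u` halts instead.
      · obtain ⟨⟨z, hz, hz', hr⟩, -⟩ := hmu.toggle hG h3
        have hv : IsMin G X Δ v := by
          by_contra hn
          exact absurd ((st_valid hG h1).fst_of_not_min hn) (lt_irrefl _)
        rw [isMin_unique hG h3 hz hvu.symm hz' hv] at hr
        exact absurd hr h2
      · exact (halts hau hf hmu).2.2
    · exact absurd (ih h1 h2' (by rwa [T.reg_idle _ _ hau] at h3)) hf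

theorem reg_of_fin {s : ℕ} (hf : T.fin t u) (hst : t ≤ s) : T.fin s u ∧ T.reg s u = T.st t u := by
  have : T.fin s u ∧ T.st s u = T.st t u := by
    induction hst with
    | refl => exact ⟨hf, rfl⟩
    | step _ ih =>
      have := fin_succ ih.1
      exact ⟨this.1, this.2.trans ih.2⟩
  exact ⟨this.1, (reg_eq_of_fin this.1).trans this.2⟩

/-- A local minimum leaves `(Δ, 0)` when a neighbor changes its first component, or for good. -/
theorem leave_top (hG : Ranked G X ident Δ) (h1 : T.st t v = some (Δ, 0))
    (h2 : T.st (t + 1) v ≠ some (Δ, 0)) :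
    (∃ u, G.Adj v u ∧ IsMax G X Δ u ∧ (T.st t u).map Prod.fst ≠ (T.st (t + 1) u).map Prod.fst) ∨
      ∀ s > t, T.st s v ≠ some (Δ, 0) := by
  have hΔ := hG.two_le
  have hm : T.Moves t v := by
    by_contra hm
    exact h2 (by rw [st_succ_of_not_moves hm, h1])
  have hv : IsMin G X Δ v := by
    by_contra hn
    exact absurd ((st_valid hG h1).fst_of_not_min hn) (lt_irrefl _)
  obtain ⟨u, ⟨c, b⟩, hu, hr, hc⟩ := hm.2.2 _ h1
  have hc0 := (reg_valid hG hr).fst_of_not_min (hv.not_isMin_adj hu)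
  have hb : b = Δ := by
    by_contra hb
    simp only [pairColor, hb, show (0 : ℕ) ≠ Δ by omega, if_false, Prod.mk.injEq] at hc
    simp only at hc0
    omega
  subst hb
  have hrv : T.reg (t + 1) v = some (b, 0) := by rw [T.reg_act _ _ hm.1, h1]
  -- A neighbor that has terminated with second component `Δ` prevents `v` from ever choosing `(Δ,
  -- 0)` again, since that choice requires `0` there.
  have hlast : ∀ r ≤ t + 1, T.fin r u → T.st r u = some (c, b) →
      ∀ s > t, T.st s v ≠ some (b, 0) := by
    intro r hr' hf hst s hs
    induction s, hs using Nat.le_induction with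
    | base => exact h2
    | succ s hs ih =>
      intro h
      by_cases hms : T.Moves s v
      · have h3 := hms.reg_of_min_top hG hu h
        rw [(reg_of_fin hf (by omega : r ≤ s + 1)).2, hst] at h3
        simp only [Option.some.injEq, Prod.mk.injEq] at h3
        omega
      · exact ih (by rwa [st_succ_of_not_moves hms] at h)
  by_cases ha : T.act t u
  · have hst : T.st t u = some (c, b) := by rwa [T.reg_act _ _ ha] at hr
    by_cases hf : T.fin t u
    · exact Or.inr (hlast t (by omega) hf hst)
    · left
      have hmu : T.Moves t u := by
        refine ⟨ha, hf, fun p hp => ⟨v, _, hu.symm, hrv, ?_⟩⟩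
        rw [hst] at hp
        simp only [Option.some.injEq] at hp
        subst hp
        simp [pairColor]
      refine ⟨u, hu, isMax_of_top hG hst, fun he => ?_⟩
      obtain ⟨-, b', -, hb'⟩ := hmu.toggle hG hst
      rw [hst, hb'] at he
      simp only [Option.map_some, Option.some.injEq] at he
      have := (st_valid hG hst).fst_of_max (isMax_of_top hG hst)
      simp only at this
      omega
  · right
    have hr' : T.reg t u = some (c, b) := by rwa [T.reg_idle _ _ ha] at hr
    -- Before step `t`, the register of `v` cannot already contain `(Δ, 0)`: by `fin_of_reg_eq`, `v`
    -- would have terminated.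
    have hf := fin_of_reg_top hG hu h1
      (fun h => hm.2.1 (fin_of_reg_eq hG (h.trans h1.symm) (by simp [h1]))) hr'
    exact hlast t (by omega) hf (by rw [← reg_eq_of_fin hf, hr'])

theorem changes_top_min (hG : Ranked G X ident Δ) (v : V) (N : ℕ) :
    changes (fun t => T.st t v = some (Δ, 0)) N ≤ 2 * (Δ * (4 * Δ + 4) + 1) + 1 := by
  classical
  refine changes_le_of_off fun S hS => ?_
  set L := S.filter fun t => ∀ s > t, T.st s v ≠ some (Δ, 0) with hL
  set F : V → Finset ℕ := fun u =>
    S.filter fun t => (T.st t u).map Prod.fst ≠ (T.st (t + 1) u).map Prod.fst with hF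
  have hcard : S.card ≤ (((nb G v).filter fun u => IsMax G X Δ u).biUnion F).card + L.card := by
    refine (Finset.card_le_card fun t ht => ?_).trans (Finset.card_union_le _ _)
    simp only [hL, hF, Finset.mem_filter, Finset.mem_union, Finset.mem_biUnion, mem_nb]
    obtain ⟨-, h1, h2⟩ := hS t ht
    rcases leave_top hG h1 h2 with ⟨u, hu, hu', h⟩ | h
    · exact Or.inl ⟨u, ⟨hu, hu'⟩, ht, h⟩
    · exact Or.inr ⟨ht, h⟩
  have hlast : L.card ≤ 1 := by
    refine Finset.card_le_one.mpr fun a ha b hb => ?_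
    have ha := Finset.mem_filter.mp ha
    have hb := Finset.mem_filter.mp hb
    rcases lt_trichotomy a b with h | h | h
    · exact absurd (hS b hb.1).2.1 (ha.2 b h)
    · exact h
    · exact absurd (hS a ha.1).2.1 (hb.2 a h)
  have hsum : (((nb G v).filter fun u => IsMax G X Δ u).biUnion F).card ≤ Δ * (4 * Δ + 4) := by
    refine Finset.card_biUnion_le.trans ((Finset.sum_le_card_nsmul _ _ (4 * Δ + 4)
      fun u hu => ?_).trans ?_)
    · refine (card_le_changes fun t ht => ?_).trans
        (changes_fst_max (T := T) hG (Finset.mem_filter.mp hu).2 N)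
      have ht := Finset.mem_filter.mp ht
      exact ⟨(hS t ht.1).1, ht.2⟩
    · rw [smul_eq_mul]
      exact Nat.mul_le_mul_right _ ((Finset.card_filter_le _ _).trans (hG.card_le v))
  omega

/-- A bound on the number of changes of the first component. -/
def fstBound (Δ : ℕ) : ℕ → ℕ
  | 0 => 0
  | k + 1 => Δ * fstBound Δ k + (4 * Δ + 4)

/-- A bound on the number of changes of the second component. -/
def sndBound (Δ : ℕ) : ℕ → ℕ
  | 0 => 0
  | k + 1 => Δ * sndBound Δ k + 1

/-- Induction on the distance to the highest rank: a higher neighbor is never a local minimum, and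
local maxima are bounded directly. Second components are bounded from the lowest rank upwards in the
same way. -/
theorem changes_fst_le (hG : Ranked G X ident Δ) {m : ℕ} (hX : ∀ v, X v < m) (k : ℕ) (v : V)
    (hv : ¬ IsMin G X Δ v) (hk : m ≤ X v + k) (N : ℕ) :
    changes (fun t => (T.st t v).map Prod.fst) N ≤ fstBound Δ k := by
  induction k generalizing v N with
  | zero => have := hX v; omega
  | succ k ih =>
    simp only [fstBound]
    by_cases hmax : IsMax G X Δ v
    · exact (changes_fst_max hG hmax N).trans (by omega)
    · refine (changes_fst_other hG hv hmax (C := fstBound Δ k) (fun w hw hx N => ?_) N).trans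
        (by omega)
      exact ih w (fun h => absurd (h.2 v hw.symm) hx.le.not_gt) (by omega) N

theorem changes_snd_le (hG : Ranked G X ident Δ) (k : ℕ) (v : V)
    (hv : ¬ IsMax G X Δ v) (hk : X v < k) (N : ℕ) :
    changes (fun t => (T.st t v).map Prod.snd) N ≤ sndBound Δ k := by
  induction k generalizing v N with
  | zero => omega
  | succ k ih =>
    refine changes_snd_other hG hv (C := sndBound Δ k) (fun w hw hx N => ?_) N
    exact ih w (fun h => absurd (h.2 v hw.symm) hx.le.not_gt) (by omega) N

theorem changes_st_other (hG : Ranked G X ident Δ) {m : ℕ} (hX : ∀ v, X v < m)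
    (hv : ¬ IsMin G X Δ v) (hv' : ¬ IsMax G X Δ v) (N : ℕ) :
    changes (fun t => T.st t v) N ≤ fstBound Δ m + sndBound Δ m := by
  refine (changes_le_add _ (fun t => (T.st t v).map Prod.fst)
    (fun t => (T.st t v).map Prod.snd) (fun t ht => ?_) N).trans
    (Nat.add_le_add (changes_fst_le hG hX m v hv (by omega) N)
      (changes_snd_le hG m v hv' (hX v) N))
  by_contra hcon
  push Not at hcon
  refine ht ?_
  rcases h1 : T.st t v with _ | ⟨a, b⟩ <;> rcases h2 : T.st (t + 1) v with _ | ⟨a', b'⟩ <;>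
    simp_all

open Classical in
/-- The part of the pair of `w` that matters for its neighbors that are local maxima. -/
def coarse (G : SimpleGraph V) (X : V → ℕ) (Δ : ℕ) (w : V) (o : Option (ℕ × ℕ)) :
    Option (ℕ × ℕ) :=
  if IsMin G X Δ w then o.map fun p => (if p.1 = Δ then Δ else 0, 0) else o

/-- A minimum has second component `0`, which is excluded anyway at a maximum with a full view, and
without a full view only second components matter there. Hence a maximum depends on a neighboring
minimum only through its visibility and whether its first component is `Δ`. This avoids a circular
count, as the moves of minima are bounded through those of maxima. -/
theorem nextPair_coarse (hG : Ranked G X ident Δ) (hu : IsMax G X Δ u)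
    {R : V → Option (ℕ × ℕ)} (hR : ∀ w p, R w = some p → Valid G X Δ w p) {o : Option (ℕ × ℕ)} :
    nextPair G X ident Δ o R u = nextPair G X ident Δ o (fun w => coarse G X Δ w (R w)) u := by
  classical
  have hΔ := hG.two_le
  have hfull : Full G (fun w => coarse G X Δ w (R w)) u ↔ Full G R u := by
    refine forall_congr' fun w => imp_congr_right fun _ => not_congr ?_
    simp only [coarse]
    split_ifs <;> simp
  have hsnd : ∀ w p, R w = some p → ∃ q, coarse G X Δ w (R w) = some q ∧ q.2 = p.2 := by
    intro w p hp
    by_cases hw : IsMin G X Δ w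
    · have := (hR w p hp).snd_of_min hw
      exact ⟨(if p.1 = Δ then Δ else 0, 0),
        by simp only [coarse, hw, if_true, hp, Option.map_some], this.symm⟩
    · exact ⟨p, by simp [coarse, hw, hp], rfl⟩
  have hsnd' : ∀ w q, coarse G X Δ w (R w) = some q → ∃ p, R w = some p ∧ q.2 = p.2 := by
    intro w q hq
    rcases hp : R w with _ | p
    · simp [coarse, hp] at hq
    · obtain ⟨q', hq', h⟩ := hsnd w p hp
      rw [hq] at hq'
      simp only [Option.some.injEq] at hq'
      exact ⟨p, rfl, hq' ▸ h⟩
  by_cases hf : Full G R u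
  · rw [nextPair_max hG hu hf, nextPair_max hG hu (hfull.mpr hf)]
    have hset : maxSet G (fun w => coarse G X Δ w (R w)) u (level Δ o) =
        maxSet G R u (level Δ o) := by
      ext b
      simp only [maxSet, Set.mem_union, Set.mem_singleton_iff, Set.mem_ofPred_eq]
      by_cases hb : b = 0
      · simp [hb]
      simp only [hb, false_or]
      refine exists_congr fun w => and_congr_right fun _ => ?_
      by_cases hw : IsMin G X Δ w
      · constructor
        · intro h
          obtain ⟨p, hp, hp'⟩ := hsnd' w _ h
          exact absurd (hp'.trans ((hR w p hp).snd_of_min hw)) hb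
        · intro h
          exact absurd ((hR w _ h).snd_of_min hw) hb
      · simp [coarse, hw]
    have hex : (∃ w p, G.Adj u w ∧ coarse G X Δ w (R w) = some p ∧ p.1 = Δ) ↔
        ∃ w p, G.Adj u w ∧ R w = some p ∧ p.1 = Δ := by
      refine exists_congr fun w => ?_
      by_cases hw : IsMin G X Δ w
      · simp only [coarse, hw, if_true]
        rcases R w with _ | p
        · simp
        · by_cases hp : p.1 = Δ
          · simp [hp]
          · simp [hp]
            omega
      · simp [coarse, hw]
    rw [hset]
    simp only [hex]
  · have hf' := mt hfull.mp hf
    rw [nextPair_other hG (fun h => hf h.2) (fun h => hf h.2),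
      nextPair_other hG (fun h => hf' h.2) (fun h => hf' h.2), upSet_eq_empty hu,
      upSet_eq_empty hu]
    congr 2
    ext b
    simp only [downSet, Set.mem_ofPred_eq]
    constructor
    · rintro ⟨w, a, hw, hx, hp⟩
      obtain ⟨q, hq, h⟩ := hsnd w _ hp
      exact ⟨w, q.1, hw, hx, by rw [hq, ← show q.2 = b from h]⟩
    · rintro ⟨w, a, hw, hx, hq⟩
      obtain ⟨p, hp, h⟩ := hsnd' w _ hq
      exact ⟨w, p.1, hw, hx, by rw [hp, show b = p.2 from h]⟩

theorem nextPair_congr {R R' : V → Option (ℕ × ℕ)} (h : ∀ w, G.Adj v w → R w = R' w)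
    (o : Option (ℕ × ℕ)) : nextPair G X ident Δ o R v = nextPair G X ident Δ o R' v := by
  have : peers G X ident R v = peers G X ident R' v := by
    ext q
    simp only [peers, Set.mem_ofPred_eq]
    refine exists_congr fun w => exists_congr fun p => ?_
    exact and_congr_right fun hw => by rw [h w hw]
  rw [nextPair, nextPair, this]

theorem newPair_level {o o' : Option (ℕ × ℕ)} (h : level Δ o = level Δ o') (x : ℕ)
    (Q : Set Peer) : newPair Δ x o Q = newPair Δ x o' Q := by
  simp only [newPair, h]

theorem level_congr {o o' : Option (ℕ × ℕ)} (h1 : o.map Prod.fst = o'.map Prod.fst)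
    (h2 : (∃ c, o = some (c, Δ)) ↔ ∃ c, o' = some (c, Δ)) : level Δ o = level Δ o' := by
  rcases o with _ | ⟨a, b⟩ <;> rcases o' with _ | ⟨a', b'⟩ <;> simp_all [level]

/-- A bound on the number of moves of a local maximum. -/
def maxBound (Δ m : ℕ) : ℕ :=
  12 * Δ + 14 + Δ * (fstBound Δ m + sndBound Δ m + (2 * (Δ * (4 * Δ + 4) + 1) + 2))

/-- The next pair depends on the level of `u` and on the coarse pairs of its neighbors. For an
ordinary neighbor all its moves are counted; for a minimum, only its appearance and its arrivals at
and departures from `(Δ, 0)`. -/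
theorem changes_st_max (hG : Ranked G X ident Δ) {m : ℕ} (hX : ∀ v, X v < m)
    (hu : IsMax G X Δ u) (N : ℕ) : changes (fun t => T.st t u) N ≤ maxBound Δ m := by
  classical
  have h1 := changes_update (ψ := fun t => T.st t u)
    (φ := fun t => some (nextPair G X ident Δ (T.st t u) (T.reg (t + 1)) u)) (fun t => by
      by_cases hm : T.Moves t u
      · right; exact hm.st_succ
      · left; exact st_succ_of_not_moves hm) N
  have h2 := changes_le_add
    (fun t => some (nextPair G X ident Δ (T.st t u) (T.reg (t + 1)) u))
    (fun t => ((T.st t u).map Prod.fst, ∃ c, T.st t u = some (c, Δ)))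
    (fun t => fun w : (nb G u : Finset V) => coarse G X Δ w (T.reg (t + 1) w))
    (fun t ht => by
      by_contra hcon
      push Not at hcon
      obtain ⟨c1, c2⟩ := hcon
      rw [Prod.mk.injEq] at c1
      refine ht ?_
      rw [nextPair_coarse hG hu fun w p hp => reg_valid hG hp,
        nextPair_coarse hG hu fun w p hp => reg_valid hG hp,
        nextPair_congr (R := fun w => coarse G X Δ w (T.reg (t + 1) w))
          (R' := fun w => coarse G X Δ w (T.reg (t + 1 + 1) w))
          (fun w hw => congrFun c2 ⟨w, mem_nb.mpr hw⟩), nextPair, nextPair,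
        newPair_level (level_congr c1.1 (iff_of_eq c1.2))]) N
  have h3 := changes_le_add (fun t => ((T.st t u).map Prod.fst, ∃ c, T.st t u = some (c, Δ)))
    (fun t => (T.st t u).map Prod.fst) (fun t => ∃ c, T.st t u = some (c, Δ)) (fun t ht => by
      by_contra hcon
      push Not at hcon
      exact ht (Prod.ext hcon.1 hcon.2)) N
  have h4 := changes_fst_max (T := T) hG hu N
  have h5 := changes_top_max (T := T) hG hu N
  have h6 : changes (fun t => fun w : (nb G u : Finset V) => coarse G X Δ w (T.reg (t + 1) w)) N ≤
      Δ * (fstBound Δ m + sndBound Δ m + (2 * (Δ * (4 * Δ + 4) + 1) + 2)) := by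
    refine (changes_le_sum _ Finset.univ (fun (w : (nb G u : Finset V)) t =>
      coarse G X Δ w (T.reg (t + 1) w)) (fun t ht => ?_) N).trans ?_
    · by_contra hcon
      push Not at hcon
      exact ht (funext fun w => hcon w (Finset.mem_univ _))
    refine (Finset.sum_le_card_nsmul _ _ (fstBound Δ m + sndBound Δ m +
      (2 * (Δ * (4 * Δ + 4) + 1) + 2)) fun w _ => ?_).trans ?_
    · have hw := mem_nb.mp w.2
      by_cases hmin : IsMin G X Δ w
      · have e1 : changes (fun t => T.reg (t + 1) w ≠ none) N ≤ 1 :=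
          changes_le_one_of_monotone (fun t h => reg_succ_ne_none h) N
        have e2 := changes_reg_succ_le (T := T) (v := w) (φ := fun o => o = some (Δ, 0))
          (fun N => changes_top_min hG w N) N
        have e3 := changes_le_add (fun t => coarse G X Δ w (T.reg (t + 1) w))
          (fun t => T.reg (t + 1) w ≠ none) (fun t => T.reg (t + 1) w = some (Δ, 0))
          (fun t ht => by
            by_contra hcon
            push Not at hcon
            obtain ⟨c1, c2⟩ := hcon
            refine ht ?_
            simp only [coarse, hmin, if_true]
            have key : ∀ s, ∀ p, T.reg s w = some p →
                (if p.1 = Δ then Δ else 0) = if T.reg s w = some (Δ, 0) then Δ else 0 := by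
              intro s p hp
              have := (reg_valid hG hp).snd_of_min hmin
              rw [hp]
              obtain ⟨a, b⟩ := p
              simp only at this
              simp [this]
            have c1' := iff_of_eq c1
            rcases hr : T.reg (t + 1) w with _ | p <;>
              rcases hr' : T.reg (t + 1 + 1) w with _ | p'
            · rfl
            · exact absurd hr (c1'.mpr (by simp [hr']))
            · exact absurd hr' (c1'.mp (by simp [hr]))
            · simp only [Option.map_some, key _ _ hr, key _ _ hr', c2]) N
        omega
      · have hmax := hu.not_isMax_adj hw
        have e1 : (fun t => coarse G X Δ w (T.reg (t + 1) w)) = fun t => T.reg (t + 1) w := by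
          funext t; simp [coarse, hmin]
        rw [e1]
        exact (changes_reg_succ_le (φ := fun o => o)
          (fun N => changes_st_other hG hX hmin hmax N) N).trans (by omega)
    · rw [smul_eq_mul, Finset.card_univ, Fintype.card_coe]
      exact Nat.mul_le_mul_right _ (hG.card_le u)
  unfold maxBound
  omega

/-- A bound on the number of moves of a node. -/
def moveBound (Δ m : ℕ) : ℕ := (Δ + 1) * (maxBound Δ m + fstBound Δ m + sndBound Δ m) + 1

/-- No neighbor of a minimum is a minimum, and the choice of a minimum does not depend on its own
pair. So its moves are counted by those of its neighbors, bounded before. -/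
theorem changes_st_le (hG : Ranked G X ident Δ) {m : ℕ} (hX : ∀ v, X v < m) (v : V) (N : ℕ) :
    changes (fun t => T.st t v) N ≤ moveBound Δ m := by
  classical
  have hnot : ∀ w, ¬ IsMin G X Δ w → ∀ N, changes (fun t => T.st t w) N ≤
      maxBound Δ m + fstBound Δ m + sndBound Δ m := by
    intro w hw N
    by_cases hmax : IsMax G X Δ w
    · exact (changes_st_max hG hX hmax N).trans (by omega)
    · exact (changes_st_other hG hX hw hmax N).trans (by omega)
  unfold moveBound
  by_cases hv : IsMin G X Δ v
  swap
  · refine (hnot v hv N).trans ?_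
    rw [Nat.add_mul]
    omega
  have hown : ∀ o R, nextPair G X ident Δ o R v = nextPair G X ident Δ none R v := by
    intro o R
    by_cases hf : Full G R v
    · rw [nextPair_min hG hv hf, nextPair_min hG hv hf]
    · rw [nextPair_other hG (fun h => hf h.2) (fun h => hf h.2),
        nextPair_other hG (fun h => hf h.2) (fun h => hf h.2)]
  have h1 := changes_update (ψ := fun t => T.st t v)
    (φ := fun t => some (nextPair G X ident Δ none (T.reg (t + 1)) v)) (fun t => by
      by_cases hm : T.Moves t v
      · right; rw [hm.st_succ, hown]
      · left; exact st_succ_of_not_moves hm) N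
  have h2 : changes (fun t => some (nextPair G X ident Δ none (T.reg (t + 1)) v)) N ≤
      Δ * (maxBound Δ m + fstBound Δ m + sndBound Δ m) := by
    refine (changes_le_sum _ (nb G v) (fun w t => T.reg (t + 1) w) (fun t ht => ?_) N).trans ?_
    · by_contra hcon
      push Not at hcon
      exact ht (by rw [nextPair_congr fun w hw => hcon w (mem_nb.mpr hw)])
    · refine (Finset.sum_le_card_nsmul _ _ (maxBound Δ m + fstBound Δ m + sndBound Δ m)
        fun w hw => ?_).trans ?_
      · exact changes_reg_succ_le (φ := fun o => o)
          (fun N => hnot w (hv.not_isMin_adj (mem_nb.mp hw)) N) N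
      · rw [smul_eq_mul]
        exact Nat.mul_le_mul_right _ (hG.card_le v)
  rw [Nat.add_mul]
  omega

end PairTrace

/-! ### Cover-free families -/

/-- A set of at most `k` elements is written with `k` digits in base `n + 1`, the digit `n` meaning
that no element is added. -/
theorem exists_decoder (n k : ℕ) : ∃ dec : ℕ → Finset ℕ,
    ∀ D ⊆ Finset.range n, D.card ≤ k → ∃ c < (n + 1) ^ k, dec c = D := by
  induction k with
  | zero =>
    refine ⟨fun _ => ∅, fun D _ hD => ⟨0, by simp, ?_⟩⟩
    exact (Finset.card_eq_zero.mp (Nat.le_zero.mp hD)).symm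
  | succ k ih =>
    obtain ⟨dec, hdec⟩ := ih
    refine ⟨fun c => if c % (n + 1) < n then insert (c % (n + 1)) (dec (c / (n + 1)))
      else dec (c / (n + 1)), fun D hD hk => ?_⟩
    rcases D.eq_empty_or_nonempty with rfl | ⟨d, hd⟩
    · obtain ⟨c, hc, h⟩ := hdec ∅ (by simp) (by simp)
      refine ⟨n + (n + 1) * c, ?_, ?_⟩
      · rw [pow_succ]; nlinarith
      · have h1 : (n + (n + 1) * c) % (n + 1) = n := by
          rw [Nat.add_mul_mod_self_left, Nat.mod_eq_of_lt (by omega)]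
        have h2 : (n + (n + 1) * c) / (n + 1) = c := by
          rw [Nat.add_mul_div_left _ _ (by omega), Nat.div_eq_of_lt (by omega), zero_add]
        beta_reduce
        rw [h1, h2, if_neg (lt_irrefl n), h]
    · have hdn : d < n := Finset.mem_range.mp (hD hd)
      obtain ⟨c, hc, h⟩ := hdec (D.erase d) ((Finset.erase_subset _ _).trans hD)
        (by rw [Finset.card_erase_of_mem hd]; omega)
      have h1 : (d + (n + 1) * c) % (n + 1) = d := by
        rw [Nat.add_mul_mod_self_left, Nat.mod_eq_of_lt (by omega)]
      have h2 : (d + (n + 1) * c) / (n + 1) = c := by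
        rw [Nat.add_mul_div_left _ _ (by omega), Nat.div_eq_of_lt (by omega), zero_add]
      refine ⟨d + (n + 1) * c, ?_, ?_⟩
      · rw [pow_succ]; nlinarith
      · beta_reduce
        rw [h1, h2, if_pos hdn, h, Finset.insert_erase hd]

/-- The number of bits of the new colors, from the number `b` of bits of the old ones. -/
def nextBits (Δ b : ℕ) : ℕ := Δ * Nat.size (2 * b + 1)

/-- For each `y ∈ Y` a bit is chosen where `x` and `y` differ. The new color encodes the list of
these positions with the bits of `x`: at most `Δ` requirements, all met by `x`, with at least one
violated by each `y`. -/
theorem exists_coverFree (Δ b : ℕ) : ∃ good : ℕ → ℕ → Prop, ∀ x < 2 ^ b, ∀ Y : Set ℕ, Y.Finite →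
    Y.ncard ≤ Δ → (∀ y ∈ Y, y < 2 ^ b) → x ∉ Y →
    ∃ c < 2 ^ nextBits Δ b, good x c ∧ ∀ y ∈ Y, ¬ good y c := by
  obtain ⟨dec, hdec⟩ := exists_decoder (2 * b) Δ
  -- An element `e` encodes the requirement that bit number `e / 2` be equal to `e % 2`.
  refine ⟨fun x c => ∀ e ∈ dec c, e % 2 = (x.testBit (e / 2)).toNat,
    fun x hx Y hY hcard hlt hxY => ?_⟩
  have hdiff : ∀ y : ℕ, ∃ i, y ∈ Y → i < b ∧ x.testBit i ≠ y.testBit i := by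
    intro y
    by_cases hy : y ∈ Y
    · have hne : x ≠ y := fun h => hxY (h ▸ hy)
      obtain ⟨i, hi⟩ : ∃ i, x.testBit i ≠ y.testBit i := by
        by_contra hcon
        push Not at hcon
        exact hne (Nat.eq_of_testBit_eq hcon)
      refine ⟨i, fun _ => ⟨?_, hi⟩⟩
      by_contra hb
      have hp : 2 ^ b ≤ 2 ^ i := Nat.pow_le_pow_right (by omega) (by omega)
      rw [Nat.testBit_lt_two_pow (hx.trans_le hp),
        Nat.testBit_lt_two_pow ((hlt y hy).trans_le hp)] at hi
      exact hi rfl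
    · exact ⟨0, fun h => absurd h hy⟩
  choose i hi using hdiff
  have hbit : ∀ z j : ℕ, (2 * j + (z.testBit j).toNat) / 2 = j ∧
      (2 * j + (z.testBit j).toNat) % 2 = (z.testBit j).toNat := by
    intro z j
    cases z.testBit j <;> simp <;> omega
  obtain ⟨c, hc, hD⟩ := hdec (hY.toFinset.image fun y => 2 * i y + (x.testBit (i y)).toNat)
    (by
      intro e he
      obtain ⟨y, hy, rfl⟩ := Finset.mem_image.mp he
      have := (hi y (hY.mem_toFinset.mp hy)).1
      have h2 := Bool.toNat_le (x.testBit (i y))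
      simp only [Finset.mem_range]
      omega)
    (Finset.card_image_le.trans (by rwa [← Set.ncard_eq_toFinset_card Y hY]))
  refine ⟨c, hc.trans_le ?_, ?_, fun y hy h => ?_⟩
  · rw [nextBits, Nat.mul_comm Δ, pow_mul]
    exact Nat.pow_le_pow_left (Nat.lt_size_self _).le _
  · intro e he
    rw [hD] at he
    obtain ⟨y, -, rfl⟩ := Finset.mem_image.mp he
    rw [(hbit x (i y)).1, (hbit x (i y)).2]
  · have := h (2 * i y + (x.testBit (i y)).toNat)
      (hD ▸ Finset.mem_image_of_mem _ (hY.mem_toFinset.mpr hy))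
    rw [(hbit x (i y)).1, (hbit x (i y)).2] at this
    have hne := (hi y hy).2
    revert this hne
    cases x.testBit (i y) <;> cases y.testBit (i y) <;> simp

/-- `good Δ b x c` says that the node of color `x` may take the new color `c`. -/
def good (Δ b : ℕ) : ℕ → ℕ → Prop := (exists_coverFree Δ b).choose

open Classical in
/-- The new color of a node of color `x` that sees the colors in `Y`. -/
def pick (Δ b x : ℕ) (Y : Set ℕ) : ℕ :=
  if h : ∃ c < 2 ^ nextBits Δ b, good Δ b x c ∧ ∀ y ∈ Y, ¬ good Δ b y c then h.choose else 0

theorem pick_spec {Δ b x : ℕ} {Y : Set ℕ} (hx : x < 2 ^ b) (hY : Y.Finite) (hc : Y.ncard ≤ Δ)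
    (hlt : ∀ y ∈ Y, y < 2 ^ b) (hxY : x ∉ Y) :
    pick Δ b x Y < 2 ^ nextBits Δ b ∧ good Δ b x (pick Δ b x Y) ∧
      ∀ y ∈ Y, ¬ good Δ b y (pick Δ b x Y) := by
  have h : ∃ c < 2 ^ nextBits Δ b, good Δ b x c ∧ ∀ y ∈ Y, ¬ good Δ b y c :=
    (exists_coverFree Δ b).choose_spec x hx Y hY hc hlt hxY
  rw [pick, dif_pos h]
  exact h.choose_spec

/-! ### The iterated logarithm -/

/-- Towers of powers of two. -/
def tower : ℕ → ℕ
  | 0 => 1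
  | k + 1 => 2 ^ tower k

theorem lt_tower (k : ℕ) : k < tower k := by
  induction k with
  | zero => simp [tower]
  | succ k ih =>
    have : tower k < tower (k + 1) := Nat.lt_two_pow_self
    omega

theorem tower_mono : Monotone tower :=
  monotone_nat_of_le_succ fun _ => Nat.lt_two_pow_self.le

/-- The conclusion is about some `j ≤ k` because iterating beyond a value at most `1` leads to
logarithms of nonpositive numbers, which need not remain small. -/
theorem exists_iterate_logb_le {k : ℕ} {x : ℝ} (h : x ≤ tower k) :
    ∃ j ≤ k, (Real.logb 2)^[j] x ≤ 1 := by
  induction k generalizing x with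
  | zero => exact ⟨0, le_rfl, by simpa [tower] using h⟩
  | succ k ih =>
    by_cases hx : x ≤ 1
    · exact ⟨0, by omega, by simpa using hx⟩
    · obtain ⟨j, hj, h'⟩ := ih (x := Real.logb 2 x) (by
        rw [Real.logb_le_iff_le_rpow (by norm_num) (by linarith), Real.rpow_natCast]
        simpa [tower] using h)
      exact ⟨j + 1, by omega, by rwa [Function.iterate_succ_apply]⟩

theorem le_tower_of_iterate_logb {k : ℕ} {x : ℝ} (h : (Real.logb 2)^[k] x ≤ 1)
    (h' : ∀ j < k, 1 < (Real.logb 2)^[j] x) : x ≤ tower k := by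
  induction k generalizing x with
  | zero => simpa [tower] using h
  | succ k ih =>
    have h0 : 1 < x := by simpa using h' 0 (by omega)
    have := ih (x := Real.logb 2 x) (by rwa [Function.iterate_succ_apply] at h)
      (fun j hj => by
        have := h' (j + 1) (by omega)
        rwa [Function.iterate_succ_apply] at this)
    rw [Real.logb_le_iff_le_rpow (by norm_num) (by linarith), Real.rpow_natCast] at this
    simpa [tower] using this

theorem logStar_le {n k : ℕ} (h : n ≤ tower k) : logStar n ≤ k := by
  obtain ⟨j, hj, h'⟩ := exists_iterate_logb_le (x := (n : ℝ)) (k := k) (by exact_mod_cast h)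
  exact (Nat.sInf_le h').trans hj

theorem le_tower_logStar (n : ℕ) : n ≤ tower (logStar n) := by
  have hne : {k : ℕ | (Real.logb 2)^[k] (n : ℝ) ≤ 1}.Nonempty := by
    obtain ⟨j, -, h⟩ := exists_iterate_logb_le (x := (n : ℝ)) (k := n)
      (by exact_mod_cast (lt_tower n).le)
    exact ⟨j, h⟩
  have h1 : (Real.logb 2)^[logStar n] (n : ℝ) ≤ 1 := Nat.sInf_mem hne
  have h2 := le_tower_of_iterate_logb h1 fun j hj => not_le.mp fun h =>
    Nat.notMem_of_lt_sInf hj h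
  exact_mod_cast h2

theorem logStar_mono : Monotone logStar := fun _ n h => logStar_le (h.trans (le_tower_logStar n))

theorem logStar_two_pow_le (n : ℕ) : logStar (2 ^ n) ≤ logStar n + 1 :=
  logStar_le (Nat.pow_le_pow_right (by norm_num) (le_tower_logStar n))

theorem one_le_logStar {n : ℕ} (h : 2 ≤ n) : 1 ≤ logStar n := by
  by_contra h'
  have := le_tower_logStar n
  rw [show logStar n = 0 by omega] at this
  simp only [tower] at this
  omega

/-- The iterated logarithm of a polynomial in `n` is `O(log* n)`. -/
theorem logStar_eval_isBigO (P : Polynomial ℕ) :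
    (fun n : ℕ => ((2 * logStar (P.eval n) : ℕ) : ℝ)) =O[atTop] fun n => (logStar n : ℝ) := by
  have ho : (fun n : ℕ => ((P.eval n : ℕ) : ℝ)) =o[atTop] fun n : ℕ => (2 : ℝ) ^ n := by
    induction P using Polynomial.induction_on' with
    | add p q hp hq => simpa using hp.add hq
    | monomial k a =>
      simpa using (isLittleO_pow_const_const_pow_of_one_lt k (one_lt_two (α := ℝ))).const_mul_left
        (a : ℝ)
  have hle : ∀ᶠ n : ℕ in atTop, P.eval n ≤ 2 ^ n := by
    filter_upwards [ho.bound one_pos] with n hn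
    rw [Real.norm_natCast, Real.norm_of_nonneg (by positivity), one_mul] at hn
    exact_mod_cast hn
  refine IsBigO.of_bound 4 ?_
  filter_upwards [hle, eventually_ge_atTop 2] with n hn h2
  have h3 := (logStar_mono hn).trans (logStar_two_pow_le n)
  have h4 := one_le_logStar h2
  rw [Real.norm_natCast, Real.norm_natCast]
  have : 2 * logStar (P.eval n) ≤ 4 * logStar n := by omega
  exact_mod_cast this

/-! ### The number of color reductions -/

theorem nextBits_mono (Δ : ℕ) : Monotone (nextBits Δ) := fun _ _ h =>
  Nat.mul_le_mul_left _ (Nat.size_le_size (by omega))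

/-- The factor `Δ` may spoil a single logarithm, so two are spent to descend one level. With `t =
tower k`, the second reduction leaves at most `Δ * (t + Δ + 3)` bits, which is at most `t * t ≤ 2 ^
t` because `t > 2 * Δ + 4`. -/
theorem nextBits_nextBits_le {Δ k b : ℕ} (hk : 2 * Δ + 4 ≤ k) (hb : b ≤ tower (k + 2)) :
    nextBits Δ (nextBits Δ b) ≤ tower (k + 1) := by
  have h1 : nextBits Δ b ≤ Δ * (tower (k + 1) + 2) := by
    refine Nat.mul_le_mul_left _ (Nat.size_le.mpr ?_)
    have : 2 ^ (tower (k + 1) + 2) = 4 * tower (k + 2) := by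
      rw [pow_add]; simp only [tower]; ring
    have h0 := lt_tower (k + 2)
    omega
  refine (nextBits_mono Δ h1).trans ?_
  set t := tower k with ht
  have hkt : k < t := lt_tower k
  have h2 : Nat.size (2 * (Δ * (tower (k + 1) + 2)) + 1) ≤ t + Δ + 3 := by
    refine Nat.size_le.mpr ?_
    have h3 : tower (k + 1) = 2 ^ t := rfl
    have h4 : 2 ^ (t + Δ + 3) = 2 ^ t * (8 * 2 ^ Δ) := by ring
    have h5 : Δ < 2 ^ Δ := Nat.lt_two_pow_self
    have h6 : 1 ≤ 2 ^ t := Nat.one_le_two_pow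
    rw [h3, h4]
    nlinarith
  have h7 : t * t ≤ 2 ^ t := by
    have : 4 ≤ t := by omega
    clear_value t
    clear ht h2 hkt
    induction t, this using Nat.le_induction with
    | base => norm_num
    | succ t h4 ih =>
      rw [pow_succ]
      nlinarith
  calc Δ * Nat.size (2 * (Δ * (tower (k + 1) + 2)) + 1) ≤ Δ * (t + Δ + 3) :=
        Nat.mul_le_mul_left _ h2
    _ ≤ t * t := by nlinarith
    _ ≤ 2 ^ t := h7

/-- The number of bits of the colors after `i` reductions, for identifiers at most `N`. -/
def bits (Δ N i : ℕ) : ℕ := (nextBits Δ)^[i] (Nat.size N)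

/-- A bound on the number of bits of the colors at the end of the reductions. -/
def finalBits (Δ : ℕ) : ℕ := tower (2 * Δ + 5)

theorem exists_bits_le (Δ N : ℕ) : ∃ i ≤ 2 * logStar N, bits Δ N i ≤ finalBits Δ := by
  have key : ∀ j b, b ≤ tower (2 * Δ + 5 + j) →
      ∃ i ≤ 2 * j, (nextBits Δ)^[i] b ≤ tower (2 * Δ + 5) := by
    intro j
    induction j with
    | zero => exact fun b hb => ⟨0, le_rfl, hb⟩
    | succ j ih =>
      intro b hb
      have hb' : b ≤ tower (2 * Δ + 4 + j + 2) := by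
        rwa [show 2 * Δ + 4 + j + 2 = 2 * Δ + 5 + (j + 1) by omega]
      obtain ⟨i, hi, h⟩ := ih (nextBits Δ (nextBits Δ b))
        ((nextBits_nextBits_le (by omega) hb').trans (tower_mono (by omega)))
      exact ⟨i + 2, by omega, h⟩
  have h1 : Nat.size N ≤ tower (logStar N) :=
    (Nat.size_le.mpr Nat.lt_two_pow_self).trans (le_tower_logStar N)
  exact key (logStar N) _ (h1.trans (tower_mono (by omega)))

/-- The number of reductions. -/
def rounds (Δ N : ℕ) : ℕ := sInf {i | bits Δ N i ≤ finalBits Δ}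

theorem rounds_le (Δ N : ℕ) : rounds Δ N ≤ 2 * logStar N :=
  let ⟨i, hi, h⟩ := exists_bits_le Δ N
  (Nat.sInf_le (show i ∈ {i | bits Δ N i ≤ finalBits Δ} from h)).trans hi

theorem bits_rounds_le (Δ N : ℕ) : bits Δ N (rounds Δ N) ≤ finalBits Δ :=
  let ⟨i, _, h⟩ := exists_bits_le Δ N
  Nat.sInf_mem (s := {i | bits Δ N i ≤ finalBits Δ}) ⟨i, h⟩

/-! ### The algorithm -/

/-- Two neighbors that have terminated have different colors. -/
theorem PairTrace.pairColor_ne_of_fin {V : Type} [Fintype V] {G : SimpleGraph V} {X ident : V → ℕ}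
    {Δ : ℕ} {T : PairTrace G X ident Δ} (t : ℕ) {u v : V} (huv : G.Adj u v)
    (hu : T.fin t u) (hv : T.fin t v) {p q : ℕ × ℕ} (hp : T.st t u = some p)
    (hq : T.st t v = some q) : pairColor Δ p ≠ pairColor Δ q := by
  -- Here `v` terminates at step `t` and `u` at step `t` or before. In both cases the final pair of
  -- `u` is in its register when `v` reads it, so `v` would have moved if the colors were equal.
  have key : ∀ (t : ℕ) {u v : V}, G.Adj u v → T.fin (t + 1) u → T.fin (t + 1) v → ¬ T.fin t v →
      ∀ {p q : ℕ × ℕ}, T.st (t + 1) u = some p → T.st (t + 1) v = some q →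
      pairColor Δ p ≠ pairColor Δ q := by
    intro t u v huv hu hv hv' p q hp hq
    have ha : T.act t v := by
      by_contra ha
      exact hv' ((T.idle t v fun h => ha h.1).2.mp hv)
    have hm : ¬ T.Moves t v := fun hm => hm.not_fin_succ hv
    have hs := (T.halts ha hv' hm).1
    intro hc
    refine hm ⟨ha, hv', fun q' hq' => ⟨u, p, huv.symm, (reg_of_fin hu le_rfl).2.trans hp, ?_⟩⟩
    rw [← hs, hq, Option.some.injEq] at hq'
    rw [← hq', hc]
  induction t generalizing p q with
  | zero => exact absurd hu (T.fin_zero u)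
  | succ t ih =>
    by_cases hv' : T.fin t v
    · by_cases hu' : T.fin t u
      · exact ih hu' hv' ((fin_succ hu').2 ▸ hp) ((fin_succ hv').2 ▸ hq)
      · exact (key t huv.symm hv hu hu' hq hp).symm
    · exact key t huv hu hv hv' hp hq

/-- The number of a pair in the enumeration of the pairs of naturals along the antidiagonals. -/
def code (p : ℕ × ℕ) : ℕ := (p.1 + p.2) * (p.1 + p.2 + 1) / 2 + p.2

/-! ### Numbering the colors -/

theorem triangle_succ (s : ℕ) : (s + 1) * (s + 1 + 1) / 2 = s * (s + 1) / 2 + (s + 1) := by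
  rw [show (s + 1) * (s + 1 + 1) = s * (s + 1) + (s + 1) * 2 by ring,
    Nat.add_mul_div_right _ _ two_pos]

theorem triangle_mono : Monotone fun s : ℕ => s * (s + 1) / 2 :=
  fun _ _ h => Nat.div_le_div_right (Nat.mul_le_mul h (by omega))

theorem code_injective : Function.Injective code := by
  have key : ∀ a b a' b' : ℕ, a + b < a' + b' → code (a, b) < code (a', b') := by
    intro a b a' b' h
    have h1 := triangle_succ (a + b)
    have h2 := triangle_mono (show a + b + 1 ≤ a' + b' from h)
    simp only [code] at h2 ⊢
    omega
  rintro ⟨a, b⟩ ⟨a', b'⟩ h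
  rcases lt_trichotomy (a + b) (a' + b') with hs | hs | hs
  · exact absurd h (key _ _ _ _ hs).ne
  · simp only [code, hs] at h
    ext <;> simp only <;> omega
  · exact absurd h (key _ _ _ _ hs).ne'

/-- Among the pairs of sum at most `Δ`, the last number `(Δ + 1) * (Δ + 2) / 2 - 1` is that of `(0,
Δ)`, the pair whose color is merged with that of `(Δ, 0)`. -/
theorem code_lt {Δ : ℕ} {p : ℕ × ℕ} (h : p.1 + p.2 ≤ Δ) (h' : p.2 < Δ) :
    code p < (Δ + 1) * (Δ + 2) / 2 - 1 := by
  have h1 := triangle_succ Δ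
  have h2 : (p.1 + p.2) * (p.1 + p.2 + 1) / 2 ≤ Δ * (Δ + 1) / 2 := triangle_mono h
  rw [show Δ + 2 = Δ + 1 + 1 from rfl, code]
  omega

theorem code_pairColor_lt {Δ : ℕ} {p : ℕ × ℕ} (hΔ : 0 < Δ) (h : p.2 = Δ ∨ p.1 + p.2 ≤ Δ) :
    code (pairColor Δ p) < (Δ + 1) * (Δ + 2) / 2 - 1 := by
  unfold pairColor
  split_ifs with hp
  · exact code_lt (by simp) hΔ
  · have := h.resolve_left hp
    exact code_lt this (by omega)

/-- The state of a node: its identifier and inputs, the colors `col 0, …, col round` that it has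
computed so far in the color reduction, its pair and its output. -/
structure NodeState where
  ident : ℕ
  deg : ℕ
  bound : ℕ
  round : ℕ
  col : ℕ → ℕ
  pair : Option (ℕ × ℕ)
  out : Option ℕ

/-- The colors number `i` in the registers that are read. -/
def colorsSeen (i : ℕ) (M : Set (Option NodeState)) : Set ℕ :=
  {x | ∃ s, some s ∈ M ∧ i ≤ s.round ∧ x = s.col i}

/-- The neighbors whose pairs are read. -/
def peersSeen (M : Set (Option NodeState)) : Set Peer :=
  {q | ∃ s p, some s ∈ M ∧ s.pair = some p ∧ q = ⟨s.ident, s.col (rounds s.deg s.bound), p⟩}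

open Classical in
/-- The update rule: first reduce the colors, then move the pair until no visible neighbor has the
same color. -/
def nextState (s : NodeState) (M : Set (Option NodeState)) : NodeState :=
  if s.round < rounds s.deg s.bound then
    { s with
      round := s.round + 1
      col := Function.update s.col (s.round + 1)
        (pick s.deg (bits s.deg s.bound s.round) (s.col s.round) (colorsSeen s.round M)) }
  else if ∃ p, s.pair = some p ∧ ∀ q ∈ peersSeen M, pairColor s.deg q.pair ≠ pairColor s.deg p then
    { s with out := s.pair.map fun p => code (pairColor s.deg p) }
  else
    { s with
      pair := some (newPair s.deg (s.col (rounds s.deg s.bound)) s.pair (peersSeen M)) }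

/-- The coloring algorithm. -/
def coloring : Algorithm (ℕ × ℕ) where
  State := NodeState
  init id inp := ⟨id, inp.1, inp.2, 0, fun _ => id, none, none⟩
  next := nextState
  output := NodeState.out

/-- `c` is an execution of the coloring algorithm. -/
structure IsRun {V : Type} (G : SimpleGraph V) (ident : V → ℕ) (Δ N : ℕ) (S : Scheduling V)
    (c : ℕ → Config NodeState V) : Prop where
  zero : c 0 = coloring.initial ident (Δ, N)
  succ : ∀ t, c (t + 1) = coloring.step G (S t) (c t)

theorem isRun_run {V : Type} (G : SimpleGraph V) (ident : V → ℕ) (Δ N : ℕ) (S : Scheduling V) :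
    IsRun G ident Δ N S (coloring.run G ident (Δ, N) S) := ⟨rfl, fun _ => rfl⟩

/-- What `v` reads at step `t`. -/
def seen {V : Type} (G : SimpleGraph V) (c : ℕ → Config NodeState V) (t : ℕ) (v : V) :
    Set (Option NodeState) := {s | ∃ u, G.Adj v u ∧ (c (t + 1)).old u = s}

namespace IsRun

variable {V : Type} [Fintype V] {G : SimpleGraph V} {ident : V → ℕ} {Δ N : ℕ} {S : Scheduling V}
  {c : ℕ → Config NodeState V} {t : ℕ} {u v : V}

/-! ### The color reduction in an execution -/

theorem old_of_mem (h : IsRun G ident Δ N S c) (hv : v ∈ S t) :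
    (c (t + 1)).old v = some ((c t).new v) := by
  rw [h.succ]
  exact if_pos hv

theorem old_of_notMem (h : IsRun G ident Δ N S c) (hv : v ∉ S t) :
    (c (t + 1)).old v = (c t).old v := by
  rw [h.succ]
  exact if_neg hv

theorem new_of_active (h : IsRun G ident Δ N S c) (hv : v ∈ S t) (ho : ((c t).new v).out = none) :
    (c (t + 1)).new v = nextState ((c t).new v) (seen G c t v) := by
  rw [seen, h.succ]
  exact if_pos ⟨hv, ho⟩

theorem new_of_idle (h : IsRun G ident Δ N S c) (hv : ¬ (v ∈ S t ∧ ((c t).new v).out = none)) :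
    (c (t + 1)).new v = (c t).new v := by
  rw [h.succ]
  exact if_neg hv

theorem const (h : IsRun G ident Δ N S c) (t : ℕ) (v : V) :
    ((c t).new v).ident = ident v ∧ ((c t).new v).deg = Δ ∧ ((c t).new v).bound = N := by
  induction t with
  | zero => rw [h.zero]; exact ⟨rfl, rfl, rfl⟩
  | succ t ih =>
    by_cases hv : v ∈ S t ∧ ((c t).new v).out = none
    · rw [h.new_of_active hv.1 hv.2, nextState]
      split_ifs <;> exact ih
    · rwa [h.new_of_idle hv]

/-- One step of the color reduction. -/
theorem new_of_lt (h : IsRun G ident Δ N S c) (hv : v ∈ S t) (ho : ((c t).new v).out = none)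
    (hr : ((c t).new v).round < rounds Δ N) :
    (c (t + 1)).new v = { (c t).new v with
      round := ((c t).new v).round + 1
      col := Function.update ((c t).new v).col (((c t).new v).round + 1)
        (pick Δ (bits Δ N ((c t).new v).round) (((c t).new v).col ((c t).new v).round)
          (colorsSeen ((c t).new v).round (seen G c t v))) } := by
  obtain ⟨-, h2, h3⟩ := h.const t v
  subst h2 h3
  rw [h.new_of_active hv ho, nextState, if_pos hr]

theorem new_of_not_lt (h : IsRun G ident Δ N S c) (hv : v ∈ S t) (ho : ((c t).new v).out = none)
    (hr : ¬ ((c t).new v).round < rounds Δ N) :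
    (∃ p, ((c t).new v).pair = some p ∧
        (∀ q ∈ peersSeen (seen G c t v), pairColor Δ q.pair ≠ pairColor Δ p) ∧
        (c (t + 1)).new v = { (c t).new v with out := some (code (pairColor Δ p)) }) ∨
      ((∀ p, ((c t).new v).pair = some p →
        ∃ q ∈ peersSeen (seen G c t v), pairColor Δ q.pair = pairColor Δ p) ∧
        (c (t + 1)).new v = { (c t).new v with
          pair := some (newPair Δ (((c t).new v).col (rounds Δ N)) ((c t).new v).pair
            (peersSeen (seen G c t v))) }) := by
  obtain ⟨-, h2, h3⟩ := h.const t v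
  subst h2 h3
  rw [h.new_of_active hv ho, nextState, if_neg hr]
  split_ifs with hp
  · obtain ⟨p, hp, hq⟩ := hp
    exact Or.inl ⟨p, hp, hq, by simp only [hp, Option.map_some]⟩
  · push Not at hp
    exact Or.inr ⟨hp, rfl⟩

theorem step_round (h : IsRun G ident Δ N S c) (t : ℕ) (v : V) :
    (((c (t + 1)).new v).round = ((c t).new v).round ∧
        ((c (t + 1)).new v).col = ((c t).new v).col) ∨
      (v ∈ S t ∧ ((c t).new v).out = none ∧ ((c t).new v).round < rounds Δ N) := by
  by_cases hv : v ∈ S t ∧ ((c t).new v).out = none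
  · by_cases hr : ((c t).new v).round < rounds Δ N
    · exact Or.inr ⟨hv.1, hv.2, hr⟩
    · left
      rcases h.new_of_not_lt hv.1 hv.2 hr with ⟨p, -, -, e⟩ | ⟨-, e⟩ <;> rw [e] <;> exact ⟨rfl, rfl⟩
  · rw [h.new_of_idle hv]
    exact Or.inl ⟨rfl, rfl⟩

theorem round_succ_le (h : IsRun G ident Δ N S c) (t : ℕ) (v : V) :
    ((c (t + 1)).new v).round ≤ ((c t).new v).round + 1 := by
  rcases h.step_round t v with e | ⟨h1, h2, h3⟩
  · omega
  · rw [h.new_of_lt h1 h2 h3]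

theorem round_le (h : IsRun G ident Δ N S c) (t : ℕ) (v : V) :
    ((c t).new v).round ≤ rounds Δ N := by
  induction t with
  | zero => rw [h.zero]; exact Nat.zero_le _
  | succ t ih =>
    rcases h.step_round t v with e | ⟨h1, h2, h3⟩
    · omega
    · rw [h.new_of_lt h1 h2 h3]
      exact h3

/-- Colors that have been computed are kept. -/
theorem col_stable (h : IsRun G ident Δ N S c) {s i : ℕ} (hst : s ≤ t)
    (hi : i ≤ ((c s).new v).round) :
    i ≤ ((c t).new v).round ∧ ((c t).new v).col i = ((c s).new v).col i := by
  induction t, hst using Nat.le_induction with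
  | base => exact ⟨hi, rfl⟩
  | succ t _ ih =>
    rcases h.step_round t v with e | ⟨h1, h2, h3⟩
    · rwa [e.1, e.2]
    · rw [h.new_of_lt h1 h2 h3]
      refine ⟨by simp only; omega, ?_⟩
      simp only
      rw [Function.update_of_ne (by omega)]
      exact ih.2

theorem exists_new_of_old (h : IsRun G ident Δ N S c) {s : NodeState}
    (hs : (c t).old v = some s) : ∃ r < t, (c r).new v = s := by
  induction t with
  | zero =>
    rw [h.zero] at hs
    exact absurd hs (by simp [Algorithm.initial])
  | succ t ih =>
    by_cases hv : v ∈ S t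
    · rw [h.old_of_mem hv, Option.some.injEq] at hs
      exact ⟨t, by omega, hs⟩
    · rw [h.old_of_notMem hv] at hs
      obtain ⟨r, hr, e⟩ := ih hs
      exact ⟨r, by omega, e⟩

/-- The register of a node lags at most one color behind. -/
theorem exists_old (h : IsRun G ident Δ N S c) {i : ℕ} (hi : i + 1 ≤ ((c t).new v).round) :
    ∃ s, (c t).old v = some s ∧ i ≤ s.round := by
  induction t with
  | zero =>
    rw [h.zero] at hi
    exact absurd hi (by simp [Algorithm.initial, coloring])
  | succ t ih =>
    by_cases hv : v ∈ S t
    · rw [h.old_of_mem hv]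
      have := h.round_succ_le t v
      exact ⟨_, rfl, by omega⟩
    · rw [h.new_of_idle fun h => hv h.1] at hi
      rw [h.old_of_notMem hv]
      exact ih hi

/-- Registers may be outdated, but computed colors never change, so what is read agrees with the
current states. -/
theorem colorsSeen_subset (h : IsRun G ident Δ N S c) (t : ℕ) (v : V) (i : ℕ) :
    colorsSeen i (seen G c t v) ⊆
      {x | ∃ u, G.Adj v u ∧ i ≤ ((c t).new u).round ∧ x = ((c t).new u).col i} := by
  rintro _ ⟨s, ⟨u, hu, hs⟩, hi, rfl⟩
  obtain ⟨r, hr, rfl⟩ := h.exists_new_of_old hs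
  have := h.col_stable (t := t) (by omega) hi
  exact ⟨u, hu, this.1, this.2.symm⟩

/-- The state of the color reduction at time `t`. -/
structure Reduced (G : SimpleGraph V) (Δ N : ℕ) (c : Config NodeState V) : Prop where
  lt : ∀ v i, i ≤ (c.new v).round → (c.new v).col i < 2 ^ bits Δ N i
  good : ∀ v i, i + 1 ≤ (c.new v).round →
    good Δ (bits Δ N i) ((c.new v).col i) ((c.new v).col (i + 1))
  proper : ∀ u v i, G.Adj u v → i ≤ (c.new u).round → i ≤ (c.new v).round →
    (c.new u).col i ≠ (c.new v).col i

theorem bits_succ (Δ N i : ℕ) : bits Δ N (i + 1) = nextBits Δ (bits Δ N i) := by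
  rw [bits, Function.iterate_succ_apply', bits]

theorem pick_new (h : IsRun G ident Δ N S c) (hdeg : ∀ v, (nb G v).card ≤ Δ)
    (hc : Reduced G Δ N (c t)) {x : ℕ} (hx : x = pick Δ (bits Δ N ((c t).new v).round)
      (((c t).new v).col ((c t).new v).round) (colorsSeen ((c t).new v).round (seen G c t v))) :
    x < 2 ^ bits Δ N (((c t).new v).round + 1) ∧
      AsyncLocal.good Δ (bits Δ N ((c t).new v).round) (((c t).new v).col ((c t).new v).round) x ∧
      ∀ y ∈ colorsSeen ((c t).new v).round (seen G c t v),
        ¬ AsyncLocal.good Δ (bits Δ N ((c t).new v).round) y x := by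
  classical
  subst hx
  rw [bits_succ]
  set i := ((c t).new v).round with hi
  have hsub := h.colorsSeen_subset t v i
  have himg : colorsSeen i (seen G c t v) ⊆
      ((nb G v).image fun u => ((c t).new u).col i : Finset ℕ) := by
    intro y hy
    obtain ⟨u, hu, -, rfl⟩ := hsub hy
    exact Finset.mem_coe.mpr (Finset.mem_image_of_mem _ (mem_nb.mpr hu))
  refine pick_spec (hc.lt v i hi.le) ((Finset.finite_toSet _).subset himg) ?_ ?_ ?_
  · refine (Set.ncard_le_ncard himg (Finset.finite_toSet _)).trans ?_
    rw [Set.ncard_coe_finset]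
    exact Finset.card_image_le.trans (hdeg v)
  · intro y hy
    obtain ⟨u, -, hu, rfl⟩ := hsub hy
    exact hc.lt u i hu
  · intro hy
    obtain ⟨u, hu, hi', e⟩ := hsub hy
    exact hc.proper v u i hu hi.le hi' e

/-- Properness in round `i + 1` comes from the node that gets there last, possibly in the same step
as its neighbor: its color is not `good` for the round-`i` color that it reads at the neighbor,
while the color of the neighbor is. -/
theorem reduced (h : IsRun G ident Δ N S c) (hdeg : ∀ v, (nb G v).card ≤ Δ)
    (hinj : Function.Injective ident) (hN : ∀ v, ident v ≤ N) (t : ℕ) : Reduced G Δ N (c t) := by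
  induction t with
  | zero =>
    rw [h.zero]
    refine ⟨fun v i hi => ?_, fun v i hi => absurd hi (Nat.not_succ_le_zero i),
      fun u v i huv _ _ e => huv.ne (hinj e)⟩
    obtain rfl : i = 0 := Nat.le_zero.mp hi
    exact (hN v).trans_lt (Nat.lt_size_self N)
  | succ t ih =>
    have hgood : ∀ v i, i + 1 ≤ ((c (t + 1)).new v).round →
        AsyncLocal.good Δ (bits Δ N i) (((c (t + 1)).new v).col i)
          (((c (t + 1)).new v).col (i + 1)) := by
      intro v i hi
      rcases h.step_round t v with e | ⟨h1, h2, h3⟩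
      · rw [e.1] at hi
        rw [e.2]
        exact ih.good v i hi
      · have hp := h.pick_new hdeg ih (v := v) rfl
        rw [h.new_of_lt h1 h2 h3] at hi ⊢
        simp only at hi ⊢
        rw [Function.update_of_ne (by omega)]
        by_cases hi' : i = ((c t).new v).round
        · subst hi'
          rw [Function.update_self]
          exact hp.2.1
        · rw [Function.update_of_ne (by omega)]
          exact ih.good v i (by omega)
    have key : ∀ u v i, G.Adj u v → i ≤ ((c (t + 1)).new u).round →
        i ≤ ((c (t + 1)).new v).round → ¬ i ≤ ((c t).new v).round →
        ((c (t + 1)).new u).col i ≠ ((c (t + 1)).new v).col i := by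
      intro u v i huv hu hv hv'
      rcases h.step_round t v with e | ⟨h1, h2, h3⟩
      · omega
      · have hp := h.pick_new hdeg ih (v := v) rfl
        have e := h.new_of_lt h1 h2 h3
        obtain rfl : i = ((c t).new v).round + 1 := by
          rw [e] at hv
          simp only at hv
          omega
        -- After step `t`, `u` has a color of the new round, so the register that `v` reads in this
        -- step contains at least the color of the preceding round.
        obtain ⟨s, hs, hsr⟩ := h.exists_old hu
        obtain ⟨r, hr, rfl⟩ := h.exists_new_of_old hs
        have hcol := (h.col_stable (t := t + 1) hr.le hsr).2
        have hng := hp.2.2 _ ⟨_, ⟨u, huv.symm, hs⟩, hsr, rfl⟩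
        have hg := hgood u _ hu
        rw [hcol] at hg
        rw [e]
        simp only [Function.update_self]
        intro e'
        rw [e'] at hg
        exact hng hg
    refine ⟨fun v i hi => ?_, hgood, fun u v i huv hu hv => ?_⟩
    · rcases h.step_round t v with e | ⟨h1, h2, h3⟩
      · rw [e.1] at hi
        rw [e.2]
        exact ih.lt v i hi
      · have hp := h.pick_new hdeg ih (v := v) rfl
        rw [h.new_of_lt h1 h2 h3] at hi ⊢
        simp only at hi ⊢
        by_cases hi' : i = ((c t).new v).round + 1
        · subst hi'
          rw [Function.update_self]
          exact hp.1
        · rw [Function.update_of_ne hi']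
          exact ih.lt v i (by omega)
    · by_cases hv' : i ≤ ((c t).new v).round
      · by_cases hu' : i ≤ ((c t).new u).round
        · rw [(h.col_stable (Nat.le_succ t) hu').2, (h.col_stable (Nat.le_succ t) hv').2]
          exact ih.proper u v i huv hu' hv'
        · exact (key v u i huv.symm hv hu hu').symm
      · exact key u v i huv hu hv hv'

/-- A node that has a pair has completed the color reduction. -/
theorem round_of_pair (h : IsRun G ident Δ N S c) (hp : ((c t).new v).pair ≠ none) :
    rounds Δ N ≤ ((c t).new v).round := by
  induction t with
  | zero =>
    rw [h.zero] at hp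
    exact absurd rfl hp
  | succ t ih =>
    by_cases hr : rounds Δ N ≤ ((c t).new v).round
    · exact (h.col_stable (Nat.le_succ t) hr).1
    · refine absurd (ih ?_) hr
      by_cases hv : v ∈ S t ∧ ((c t).new v).out = none
      · rw [h.new_of_lt hv.1 hv.2 (not_le.mp hr)] at hp
        exact hp
      · rwa [h.new_of_idle hv] at hp

theorem out_spec (h : IsRun G ident Δ N S c) {x : ℕ} (hx : ((c t).new v).out = some x) :
    ∃ p, ((c t).new v).pair = some p ∧ x = code (pairColor Δ p) := by
  induction t with
  | zero =>
    rw [h.zero] at hx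
    exact absurd hx (by simp [Algorithm.initial, coloring])
  | succ t ih =>
    by_cases hv : v ∈ S t ∧ ((c t).new v).out = none
    · by_cases hr : ((c t).new v).round < rounds Δ N
      · rw [h.new_of_lt hv.1 hv.2 hr] at hx ⊢
        exact ih hx
      · rcases h.new_of_not_lt hv.1 hv.2 hr with ⟨p, hp, -, e⟩ | ⟨-, e⟩ <;> rw [e] at hx ⊢
        · exact ⟨p, hp, (Option.some.inj hx).symm⟩
        · exact absurd (hv.2.symm.trans hx) (by simp)
    · rw [h.new_of_idle hv] at hx ⊢
      exact ih hx

/-- The nodes that complete the color reduction. -/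
def Reaches (Δ N : ℕ) (c : ℕ → Config NodeState V) (v : V) : Prop :=
  ∃ t, rounds Δ N ≤ ((c t).new v).round

/-- The subgraph of the nodes that complete the color reduction. -/
def reached (G : SimpleGraph V) (Δ N : ℕ) (c : ℕ → Config NodeState V) : SimpleGraph V where
  Adj u v := G.Adj u v ∧ Reaches Δ N c u ∧ Reaches Δ N c v
  symm := ⟨fun _ _ h => ⟨h.1.symm, h.2.2, h.2.1⟩⟩
  loopless := ⟨fun v h => G.loopless.irrefl v h.1⟩

open Classical in
/-- The color of a node at the end of the color reduction. -/
def finalColor (Δ N : ℕ) (c : ℕ → Config NodeState V) (v : V) : ℕ :=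
  if h : Reaches Δ N c v then ((c h.choose).new v).col (rounds Δ N) else 0

/-! ### The second phase as a `PairTrace` -/

theorem finalColor_eq (h : IsRun G ident Δ N S c) (hr : rounds Δ N ≤ ((c t).new v).round) :
    finalColor Δ N c v = ((c t).new v).col (rounds Δ N) := by
  have hv : Reaches Δ N c v := ⟨t, hr⟩
  rw [finalColor, dif_pos hv]
  rcases le_total hv.choose t with hle | hle
  · exact (h.col_stable hle hv.choose_spec).2.symm
  · exact (h.col_stable hle hr).2

/-- A register that contains a pair belongs to a node that has completed the reduction. Nodes that
never complete it are invisible in the second phase, so the restriction to `reached` loses nothing.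
-/
theorem peersSeen_eq (h : IsRun G ident Δ N S c) (hv : Reaches Δ N c v) (t : ℕ) :
    peersSeen (seen G c t v) = peers (reached G Δ N c) (finalColor Δ N c) ident
      (fun w => ((c (t + 1)).old w).bind NodeState.pair) v := by
  have key : ∀ {w s p}, (c (t + 1)).old w = some s → s.pair = some p → Reaches Δ N c w ∧
      s.ident = ident w ∧ s.col (rounds s.deg s.bound) = finalColor Δ N c w := by
    intro w s p hs hp
    obtain ⟨r, -, rfl⟩ := h.exists_new_of_old hs
    have hr := h.round_of_pair (t := r) (v := w) (by simp [hp])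
    obtain ⟨h1, h2, h3⟩ := h.const r w
    refine ⟨⟨r, hr⟩, h1, ?_⟩
    rw [h2, h3, h.finalColor_eq hr]
  ext q
  constructor
  · rintro ⟨s, p, ⟨w, hw, hs⟩, hp, rfl⟩
    obtain ⟨h1, h2, h3⟩ := key hs hp
    exact ⟨w, p, ⟨hw, hv, h1⟩, by simp [hs, hp], by rw [h2, h3]⟩
  · rintro ⟨w, p, hw, hp, rfl⟩
    obtain ⟨s, hs, hp⟩ := Option.bind_eq_some_iff.mp hp
    obtain ⟨h1, h2, h3⟩ := key hs hp
    exact ⟨s, p, ⟨w, hw.1, hs⟩, hp, by rw [h2, h3]⟩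

/-- Nodes that never complete the reduction have the default rank `0`, which need not be proper; in
`reached` they have no neighbors. -/
theorem ranked (h : IsRun G ident Δ N S c) (hΔ : 2 ≤ Δ) (hdeg : ∀ v, (nb G v).card ≤ Δ)
    (hinj : Function.Injective ident) (hN : ∀ v, ident v ≤ N) :
    Ranked (reached G Δ N c) (finalColor Δ N c) ident Δ where
  two_le := hΔ
  card_le v := (Finset.card_le_card fun w hw =>
    mem_nb.mpr (show (reached G Δ N c).Adj v w from mem_nb.mp hw).1).trans (hdeg v)
  inj := hinj
  proper u v huv := by
    obtain ⟨huv, ⟨t, hu⟩, ⟨s, hv⟩⟩ := huv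
    have hu' := (h.col_stable (le_max_left t s) hu).1
    have hv' := (h.col_stable (le_max_right t s) hv).1
    rw [h.finalColor_eq hu', h.finalColor_eq hv']
    exact (h.reduced hdeg hinj hN (max t s)).proper u v _ huv hu' hv'

theorem finalColor_lt (h : IsRun G ident Δ N S c) (hdeg : ∀ v, (nb G v).card ≤ Δ)
    (hinj : Function.Injective ident) (hN : ∀ v, ident v ≤ N) (v : V) :
    finalColor Δ N c v < 2 ^ finalBits Δ := by
  by_cases hv : Reaches Δ N c v
  · obtain ⟨t, ht⟩ := hv
    rw [h.finalColor_eq ht]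
    exact ((h.reduced hdeg hinj hN t).lt v _ ht).trans_le
      (Nat.pow_le_pow_right two_pos (bits_rounds_le Δ N))
  · rw [finalColor, dif_neg hv]
    positivity

/-- The second part of an execution. -/
def pairTrace (h : IsRun G ident Δ N S c) :
    PairTrace (reached G Δ N c) (finalColor Δ N c) ident Δ where
  act t v := v ∈ S t ∧ rounds Δ N ≤ ((c t).new v).round
  st t v := ((c t).new v).pair
  reg t v := ((c t).old v).bind NodeState.pair
  fin t v := ((c t).new v).out ≠ none
  st_zero v := by rw [h.zero]; rfl
  reg_zero v := by rw [h.zero]; rfl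
  fin_zero v := by rw [h.zero]; exact fun h => h rfl
  reg_act t v hv := by rw [h.old_of_mem hv.1]; rfl
  reg_idle t v hv := by
    -- An activation during the reduction is not counted in `act`: it writes a state without pair
    -- over a register without pair.
    by_cases hS : v ∈ S t
    · have hr : ¬ rounds Δ N ≤ ((c t).new v).round := fun hr => hv ⟨hS, hr⟩
      rw [h.old_of_mem hS]
      have h1 : ((c t).new v).pair = none := not_not.mp fun hp => hr (h.round_of_pair hp)
      have h2 : ((c t).old v).bind NodeState.pair = none := by
        by_contra hp
        obtain ⟨p, hp⟩ := Option.ne_none_iff_exists'.mp hp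
        obtain ⟨s, hs, hp⟩ := Option.bind_eq_some_iff.mp hp
        obtain ⟨r, hrt, rfl⟩ := h.exists_new_of_old hs
        exact hr (h.col_stable hrt.le (h.round_of_pair (by simp [hp]))).1
      rw [h2]
      exact h1
    · rw [h.old_of_notMem hS]
  idle t v hv := by
    by_cases hv' : v ∈ S t ∧ ((c t).new v).out = none
    · have hr : ((c t).new v).round < rounds Δ N := by
        by_contra hr
        exact hv ⟨⟨hv'.1, not_lt.mp hr⟩, not_not.mpr hv'.2⟩
      rw [h.new_of_lt hv'.1 hv'.2 hr]
      exact ⟨rfl, Iff.rfl⟩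
    · rw [h.new_of_idle hv']
      exact ⟨rfl, Iff.rfl⟩
  halt t v p hv hf hp hq := by
    rw [← h.peersSeen_eq ⟨t, hv.2⟩ t] at hq
    rcases h.new_of_not_lt hv.1 (not_not.mp hf) (not_lt.mpr hv.2) with ⟨p', hp', -, e⟩ | ⟨hm, -⟩
    · rw [e]
      exact ⟨hp, by simp⟩
    · obtain ⟨q, hq', e⟩ := hm p hp
      exact absurd e (hq q hq')
  move t v hv hf hm := by
    rw [← h.peersSeen_eq ⟨t, hv.2⟩ t] at hm ⊢
    rcases h.new_of_not_lt hv.1 (not_not.mp hf) (not_lt.mpr hv.2) with ⟨p, hp, hq, -⟩ | ⟨-, e⟩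
    · obtain ⟨q, hq', e⟩ := hm p hp
      exact absurd e (hq q hq')
    · rw [e, h.finalColor_eq hv.2]
      exact ⟨rfl, hf⟩

/-! ### Runtime and outputs -/

open Classical in
theorem reduction_card_le (h : IsRun G ident Δ N S c) (v : V) (n : ℕ) :
    ((Finset.range n).filter fun t => (v ∈ S t ∧ ((c t).new v).out = none) ∧
      ((c t).new v).round < rounds Δ N).card ≤ ((c n).new v).round := by
  induction n with
  | zero => simp
  | succ n ih =>
    rw [Finset.range_add_one, Finset.filter_insert]
    split_ifs with hn
    · rw [Finset.card_insert_of_notMem (by simp), h.new_of_lt hn.1.1 hn.1.2 hn.2]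
      exact Nat.add_le_add_right ih 1
    · exact ih.trans (h.col_stable (Nat.le_succ n) le_rfl).1

open Classical in
-- An activation before termination either advances the reduction by a round or is an active step of
-- the second phase. The first kind is bounded by `rounds Δ N`, the second in terms of `Δ` alone.
theorem active_card_le (h : IsRun G ident Δ N S c) (hΔ : 2 ≤ Δ) (hdeg : ∀ v, (nb G v).card ≤ Δ)
    (hinj : Function.Injective ident) (hN : ∀ v, ident v ≤ N) (v : V) (n : ℕ) :
    ((Finset.range n).filter fun t => v ∈ S t ∧ ((c t).new v).out = none).card ≤
      rounds Δ N + (PairTrace.moveBound Δ (2 ^ finalBits Δ) + 1) := by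
  have hG := h.ranked hΔ hdeg hinj hN
  have h1 := (h.reduction_card_le v n).trans (h.round_le n v)
  have h2 := ((h.pairTrace).active_card_le hG v n).trans (Nat.add_le_add_right
    (h.pairTrace.changes_st_le hG (h.finalColor_lt hdeg hinj hN) v n) 1)
  rw [← Finset.card_filter_add_card_filter_not (s := (Finset.range n).filter fun t =>
    v ∈ S t ∧ ((c t).new v).out = none) fun t => ((c t).new v).round < rounds Δ N]
  refine Nat.add_le_add ?_ ((Finset.card_le_card fun t ht => ?_).trans h2)
  · rwa [Finset.filter_filter]
  · simp only [Finset.mem_filter, not_lt] at ht ⊢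
    exact ⟨ht.1.1, ⟨ht.1.2.1, ht.2⟩, not_not.mpr ht.1.2.2⟩

theorem out_stable (h : IsRun G ident Δ N S c) {s x : ℕ} (hst : s ≤ t)
    (hx : ((c s).new v).out = some x) : ((c t).new v).out = some x := by
  induction t, hst using Nat.le_induction with
  | base => exact hx
  | succ t _ ih => rwa [h.new_of_idle (by simp [ih])]

theorem out_lt (h : IsRun G ident Δ N S c) (hΔ : 2 ≤ Δ) (hdeg : ∀ v, (nb G v).card ≤ Δ)
    (hinj : Function.Injective ident) (hN : ∀ v, ident v ≤ N) {x : ℕ}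
    (hx : ((c t).new v).out = some x) : x < (Δ + 1) * (Δ + 2) / 2 - 1 := by
  obtain ⟨p, hp, rfl⟩ := h.out_spec hx
  exact code_pairColor_lt (by omega)
    ((h.pairTrace).st_valid (h.ranked hΔ hdeg hinj hN) (t := t) (v := v) hp).sum_le

theorem out_ne (h : IsRun G ident Δ N S c) (huv : G.Adj u v) {s x y : ℕ}
    (hx : ((c s).new u).out = some x) (hy : ((c t).new v).out = some y) : x ≠ y := by
  replace hx := h.out_stable (le_max_left s t) hx
  replace hy := h.out_stable (le_max_right s t) hy
  obtain ⟨p, hp, rfl⟩ := h.out_spec hx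
  obtain ⟨q, hq, rfl⟩ := h.out_spec hy
  intro e
  refine (h.pairTrace).pairColor_ne_of_fin (max s t) (u := u) (v := v)
    ⟨huv, ⟨_, h.round_of_pair (t := max s t) (by simp [hp])⟩,
      ⟨_, h.round_of_pair (t := max s t) (by simp [hq])⟩⟩ ?_ ?_ hp hq (code_injective e)
  · exact fun h => by simp [hx] at h
  · exact fun h => by simp [hy] at h

end IsRun

theorem encard_le_of_forall_range {p : ℕ → Prop} [DecidablePred p] {k : ℕ}
    (h : ∀ n, ((Finset.range n).filter p).card ≤ k) : {t | p t}.encard ≤ (k : ℕ∞) := by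
  by_contra! hlt
  obtain ⟨s, hs, hk⟩ := Set.exists_subset_encard_eq (Order.add_one_le_of_lt hlt)
  have hfin : s.Finite := Set.finite_of_encard_eq_coe (k := k + 1) (by simpa using hk)
  obtain ⟨n, hn⟩ := hfin.bddAbove
  have h1 : hfin.toFinset ⊆ (Finset.range (n + 1)).filter p := fun t ht => by
    have := hfin.mem_toFinset.mp ht
    exact Finset.mem_filter.mpr ⟨Finset.mem_range.mpr (Nat.lt_succ_of_le (hn this)), hs this⟩
  have h2 := (Finset.card_le_card h1).trans (h (n + 1))
  rw [hfin.encard_eq_coe_toFinset_card] at hk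
  have h3 : hfin.toFinset.card = k + 1 := by exact_mod_cast hk
  omega

end AsyncLocal

end

/-! ### The main theorem -/

theorem theorem3 :
    ∃ (A : AsyncLocal.Algorithm (ℕ × ℕ)) (f : ℕ → ℕ),
      ∀ P : Polynomial ℕ, ∃ r : ℕ → ℕ,
        ((fun n => (r n : ℝ)) =O[atTop] fun n => (AsyncLocal.logStar n : ℝ)) ∧
        ∀ (Δ : ℕ), 2 ≤ Δ →
        ∀ (V : Type) [Fintype V] (G : SimpleGraph V) [DecidableRel G.Adj],
          (∀ v, G.degree v ≤ Δ) →
        ∀ (N : ℕ), N ≤ P.eval (Fintype.card V) →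
        ∀ (ident : V → ℕ), Function.Injective ident → (∀ v, 1 ≤ ident v ∧ ident v ≤ N) →
        ∀ (S : AsyncLocal.Scheduling V),
          A.ProperlyColors G ident (Δ, N) S ((Δ + 1) * (Δ + 2) / 2 - 1) ∧
          ∀ v, A.runtime G ident (Δ, N) S v ≤ ((r (Fintype.card V) + f Δ : ℕ) : ℕ∞) := by
  refine ⟨AsyncLocal.coloring,
    fun Δ => AsyncLocal.PairTrace.moveBound Δ (2 ^ AsyncLocal.finalBits Δ) + 1, fun P =>
    ⟨fun n => 2 * AsyncLocal.logStar (P.eval n), AsyncLocal.logStar_eval_isBigO P, ?_⟩⟩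
  intro Δ hΔ V _ G _ hdeg N hN ident hinj hident S
  have h := AsyncLocal.isRun_run G ident Δ N S
  have hid : ∀ v, ident v ≤ N := fun v => (hident v).2
  have hnb : ∀ v, (AsyncLocal.nb G v).card ≤ Δ := fun v => by
    refine le_trans (Finset.card_le_card fun w hw => ?_) (hdeg v)
    exact (G.mem_neighborFinset v w).mpr (AsyncLocal.mem_nb.mp hw)
  refine ⟨⟨?_, ?_⟩, fun v => ?_⟩
  · rintro v x ⟨t, ht⟩
    exact h.out_lt hΔ hnb hinj hid ht
  · rintro u v x y huv ⟨s, hs⟩ ⟨t, ht⟩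
    exact h.out_ne huv hs ht
  · classical
    refine (AsyncLocal.encard_le_of_forall_range (p := fun t => v ∈ S t ∧
      ((AsyncLocal.coloring.run G ident (Δ, N) S t).new v : AsyncLocal.NodeState).out = none)
      (h.active_card_le hΔ hnb hinj hid v)).trans (Nat.cast_le.mpr ?_)
    exact Nat.add_le_add_right ((AsyncLocal.rounds_le Δ N).trans
      (Nat.mul_le_mul_left 2 (AsyncLocal.logStar_mono hN))) _
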